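/- Conventions. For a unital commutative $C^*$-algebra $A$, a Hilbert $A$-module is a right $A$-module $X$ with an $A$-valued inner product $\langle\cdot,\cdot\rangle_A$ that is $\mathbb C$-linear and $A$-linear in the second variable, satisfies $\langle y,x\rangle_A=\langle x,y\rangle_A^*$ and $\langle x,x\rangle_A\ge 0$ with equality only for $x=0$, and such that $X$ is complete for the norm $\|x\|=\|\langle x,x\rangle_A\|^{1/2}$. Isomorphisms ($\cong$) of Hilbert $A$-modules are $A$-module isomorphisms preserving the $A$-valued inner products. For a set $J$, $\bigoplus_{j\in J}A$ denotes the Hilbert $A$-module of families $(a_j)_{j\in J}$ in $A$ for which $\sum_j a_j^*a_j$ converges in norm, with $\langle (a_j),(b_j)\rangle_A=\sum_j a_j^*b_j$. A family $(x_j)_{j\in J}$ in $X$ is a frame of $X$ if there is a real constant $C>0$ such that for every $x\in X$ the sum $\sum_{j\in J}\langle x,x_j\rangle_A\langle x_j,x\rangle_A$ converges in the ultraweak operator topology to an element of the universal enveloping von Neumann algebra $A^{**}$ of $A$ and $$C\langle x,x\rangle_A\le\sum_{j\in J}\langle x,x_j\rangle_A\langle x_j,x\rangle_A\le C^{-1}\langle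 x,x\rangle_A .$$ It is a standard frame if moreover these sums converge in norm for every $x\in X$. Theorem. Let $A$ be a unital commutative $C^*$-algebra. The following are equivalent: (1) $A$ is finite-dimensional; (2) for every Hilbert $A$-module $X$ there is a set $J$ such that $X\oplus\bigl(\bigoplus_{j\in J}A\bigr)\cong\bigoplus_{j\in J}A$; (3) for every Hilbert $A$-module $X$ there are a set $J$ and a Hilbert $A$-module $Y$ such that $X\oplus Y\cong\bigoplus_{j\in J}A$; (4) every Hilbert $A$-module has a standard frame; (5) every Hilbert $A$-module has a frame. In particular, if $A$ is infinite-dimensional, then there is a Hilbert $A$-module $X$ that has no frame and for which $X\oplus\bigl(\bigoplus_{j\in J}A\bigr)\not\cong\bigoplus_{j\in J}A$ for every set $J$. -/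

import Mathlib

open scoped ComplexOrder InnerProductSpace WithCStarModule ENNReal

universe u

/-!
## Hilbert modules

A Hilbert `A`-module is a complete `CStarModule A X`.  All algebras below are commutative, so left
and right modules coincide and `a • x` is the element written `x a` for a right module.
-/

/-- Two Hilbert `A`-modules are isomorphic if there is an `A`-module isomorphism between them that
preserves the `A`-valued inner products. -/
def HilbertModuleIso (A : Type*) [CommCStarAlgebra A] [PartialOrder A]
    (X Y : Type*) [NormedAddCommGroup X] [NormedSpace ℂ X] [Module A X] [CStarModule A X]
    [NormedAddCommGroup Y] [NormedSpace ℂ Y] [Module A Y] [CStarModule A Y] : Prop :=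
  ∃ e : X ≃ₗ[A] Y, ∀ x y : X, inner A (e x) (e y) = inner A x y

section StandardModule

variable {A : Type*} [CommCStarAlgebra A] [PartialOrder A] [StarOrderedRing A] {J : Type*}

theorem norm_sum_star_mul_sq_le (f g : J → A) (s : Finset J) :
    ‖∑ j ∈ s, star (f j) * g j‖ ^ 2 ≤
      ‖∑ j ∈ s, star (f j) * f j‖ * ‖∑ j ∈ s, star (g j) * g j‖ := by
  let F : C⋆ᵐᵒᵈ(A, s → A) := (WithCStarModule.equiv A (s → A)).symm fun j => f j
  let G : C⋆ᵐᵒᵈ(A, s → A) := (WithCStarModule.equiv A (s → A)).symm fun j => g j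
  have key (a b : J → A) :
      inner A ((WithCStarModule.equiv A (s → A)).symm fun j : s => a j)
        ((WithCStarModule.equiv A (s → A)).symm fun j : s => b j) =
      ∑ j ∈ s, star (a j) * b j := by
    rw [WithCStarModule.pi_inner, ← Finset.sum_coe_sort s]
    exact Finset.sum_congr rfl fun j _ => mul_comm _ _
  have h := CStarModule.norm_inner_le (A := A) C⋆ᵐᵒᵈ(A, s → A) (x := F) (y := G)
  rw [← key f g, ← key f f, ← key g g, ← CStarModule.norm_sq_eq A, ← CStarModule.norm_sq_eq A,
    ← mul_pow]
  exact pow_le_pow_left₀ (norm_nonneg _) h 2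

theorem summable_star_mul {f g : J → A} (hf : Summable fun j => star (f j) * f j)
    (hg : Summable fun j => star (g j) * g j) : Summable fun j => star (f j) * g j := by
  rw [summable_iff_vanishing_norm] at hf hg ⊢
  intro ε hε
  obtain ⟨s, hs⟩ := hf ε hε
  obtain ⟨t, ht⟩ := hg ε hε
  classical
  refine ⟨s ∪ t, fun r hr => ?_⟩
  have h1 := hs r (Finset.disjoint_of_subset_right Finset.subset_union_left hr)
  have h2 := ht r (Finset.disjoint_of_subset_right Finset.subset_union_right hr)
  have h3 := norm_sum_star_mul_sq_le f g r
  refine lt_of_pow_lt_pow_left₀ 2 hε.le (h3.trans_lt ?_)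
  rw [sq]
  exact mul_lt_mul'' h1 h2 (norm_nonneg _) (norm_nonneg _)

variable (A J)

/-- The families `(a_j)` in `A` such that `∑ a_j* a_j` converges in norm. -/
def standardSubmodule : Submodule A (J → A) where
  carrier := {f | Summable fun j => star (f j) * f j}
  zero_mem' := by simp
  add_mem' {f g} hf hg := by
    have h := ((hf.add (summable_star_mul hf hg)).add (summable_star_mul hg hf)).add hg
    refine h.congr fun j => ?_
    simp only [Pi.add_apply, star_add]
    ring
  smul_mem' a f hf := by
    have h := hf.mul_left (star a * a)
    refine h.congr fun j => ?_
    simp only [Pi.smul_apply, smul_eq_mul, star_mul]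
    ring

/-- The direct sum `⊕_{j ∈ J} A` of copies of the Hilbert `A`-module `A`. -/
def StandardModule : Type _ := standardSubmodule A J

namespace StandardModule

noncomputable instance : AddCommGroup (StandardModule A J) :=
  inferInstanceAs (AddCommGroup (standardSubmodule A J))

noncomputable instance : Module A (StandardModule A J) :=
  inferInstanceAs (Module A (standardSubmodule A J))

noncomputable instance : Module ℂ (StandardModule A J) :=
  inferInstanceAs (Module ℂ (standardSubmodule A J))

instance : CoeFun (StandardModule A J) fun _ => J → A := ⟨Subtype.val⟩

variable {A J}

@[simp] theorem add_apply (f g : StandardModule A J) (j : J) : (f + g) j = f j + g j := rfl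

@[simp] theorem smul_apply (a : A) (f : StandardModule A J) (j : J) : (a • f) j = a * f j := rfl

@[simp] theorem complex_smul_apply (c : ℂ) (f : StandardModule A J) (j : J) :
    (c • f) j = c • f j := rfl

theorem summable_inner (f g : StandardModule A J) : Summable fun j => star (f j) * g j :=
  summable_star_mul f.2 g.2

noncomputable instance : Norm (StandardModule A J) where
  norm f := √‖∑' j, star (f j) * f j‖

/-- The inner product `⟨f, g⟩ = ∑ f_j* g_j`, a norm convergent sum. -/
noncomputable instance : CStarModule A (StandardModule A J) where
  inner f g := ∑' j, star (f j) * g j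
  inner_add_right {f g h} := by
    rw [← (summable_inner f g).tsum_add (summable_inner f h)]
    exact tsum_congr fun j => mul_add _ _ _
  inner_self_nonneg {f} := tsum_nonneg fun j => star_mul_self_nonneg _
  inner_self {f} := by
    refine ⟨fun h => ?_, fun h => ?_⟩
    · have h' := (hasSum_zero_iff_of_nonneg (fun j => star_mul_self_nonneg (f j))).1
        (h ▸ (summable_inner f f).hasSum)
      refine Subtype.ext (funext fun j => ?_)
      exact CStarRing.star_mul_self_eq_zero_iff (f j) |>.1 (congrFun h' j)
    · subst h
      have : ∀ j, (0 : StandardModule A J) j = 0 := fun j => rfl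
      simp [this]
  inner_op_smul_right {a f g} := by
    rw [← (summable_inner f g).tsum_mul_left]
    exact tsum_congr fun j => mul_left_comm _ _ _
  inner_smul_right_complex {c f g} := by
    rw [← (summable_inner f g).tsum_const_smul]
    exact tsum_congr fun j => mul_smul_comm _ _ _
  star_inner f g := by
    rw [tsum_star]
    exact tsum_congr fun j => by rw [star_mul, star_star]
  norm_eq_sqrt_norm_inner_self f := rfl

noncomputable instance : NormedAddCommGroup (StandardModule A J) :=
  NormedAddCommGroup.ofCore (CStarModule.normedSpaceCore A)

noncomputable instance : NormedSpace ℂ (StandardModule A J) :=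
  NormedSpace.ofCore (CStarModule.normedSpaceCore A)

theorem inner_def (f g : StandardModule A J) : inner A f g = ∑' j, star (f j) * g j := rfl

theorem norm_sq_eq_tsum (f : StandardModule A J) : ‖f‖ ^ 2 = ‖∑' j, star (f j) * f j‖ :=
  CStarModule.norm_sq_eq A

theorem norm_sum_le (f : StandardModule A J) (s : Finset J) :
    ‖∑ j ∈ s, star (f j) * f j‖ ≤ ‖f‖ ^ 2 := by
  rw [norm_sq_eq_tsum]
  exact CStarAlgebra.norm_le_norm_of_nonneg_of_le
    (Finset.sum_nonneg fun j _ => star_mul_self_nonneg _)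
    ((summable_inner f f).sum_le_tsum s fun j _ => star_mul_self_nonneg _)

theorem norm_apply_le (f : StandardModule A J) (j : J) : ‖f j‖ ≤ ‖f‖ := by
  have h := norm_sum_le f {j}
  rw [Finset.sum_singleton, CStarRing.norm_star_mul_self, ← sq] at h
  exact le_of_sq_le_sq h (norm_nonneg _)

instance : CompleteSpace (StandardModule A J) := by
  refine Metric.complete_of_cauchySeq_tendsto fun u hu => ?_
  have hc (j : J) : CauchySeq fun n => u n j := by
    rw [Metric.cauchySeq_iff] at hu ⊢
    intro ε hε
    obtain ⟨N, hN⟩ := hu ε hε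
    refine ⟨N, fun m hm n hn => lt_of_le_of_lt ?_ (hN m hm n hn)⟩
    rw [dist_eq_norm, dist_eq_norm]
    exact norm_apply_le (u m - u n) j
  choose g hg using fun j => cauchySeq_tendsto_of_complete (hc j)
  have key : ∀ ε > 0, ∃ N, ∀ n ≥ N, ∀ s : Finset J,
      ‖∑ j ∈ s, star (u n j - g j) * (u n j - g j)‖ ≤ ε := by
    intro ε hε
    obtain ⟨N, hN⟩ := Metric.cauchySeq_iff.1 hu (√ε) (Real.sqrt_pos.2 hε)
    refine ⟨N, fun n hn s => ?_⟩
    have ht : Filter.Tendsto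
        (fun m => ‖∑ j ∈ s, star (u n j - u m j) * (u n j - u m j)‖) Filter.atTop
        (nhds ‖∑ j ∈ s, star (u n j - g j) * (u n j - g j)‖) := by
      refine (tendsto_finsetSum s fun j _ => ?_).norm
      exact ((tendsto_const_nhds.sub (hg j)).star).mul (tendsto_const_nhds.sub (hg j))
    refine le_of_tendsto ht (Filter.eventually_atTop.2 ⟨N, fun m hm => ?_⟩)
    refine (norm_sum_le (u n - u m) s).trans ?_
    have h := hN n hn m hm
    rw [dist_eq_norm] at h
    exact (pow_le_pow_left₀ (norm_nonneg _) h.le 2).trans_eq (Real.sq_sqrt hε.le)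
  have hsum : Summable fun j => star (g j) * g j := by
    rw [summable_iff_vanishing_norm]
    intro ε hε
    obtain ⟨N, hN⟩ := key (ε / 8) (by positivity)
    obtain ⟨s, hs⟩ := summable_iff_vanishing_norm.1 (u N).2 (ε / 8) (by positivity)
    refine ⟨s, fun t ht => ?_⟩
    have h1 := hN N le_rfl t
    have h2 := hs t ht
    have h3 : ∑ j ∈ t, star (g j) * g j ≤
        2 • ∑ j ∈ t, star (u N j - g j) * (u N j - g j) + 2 • ∑ j ∈ t, star (u N j) * u N j := by
      rw [← sub_nonneg, Finset.smul_sum, Finset.smul_sum, ← Finset.sum_add_distrib,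
        ← Finset.sum_sub_distrib]
      refine Finset.sum_nonneg fun j _ => ?_
      have h := star_mul_self_nonneg (u N j + (u N j - g j))
      convert h using 1
      simp only [star_add, star_sub]
      ring
    have h4 := CStarAlgebra.norm_le_norm_of_nonneg_of_le
      (Finset.sum_nonneg fun j _ => star_mul_self_nonneg (g j)) h3
    have h5 := h4.trans (norm_add_le _ _)
    rw [two_nsmul, two_nsmul] at h5
    have h6 := norm_add_le (∑ j ∈ t, star (u N j - g j) * (u N j - g j))
      (∑ j ∈ t, star (u N j - g j) * (u N j - g j))
    have h7 := norm_add_le (∑ j ∈ t, star (u N j) * u N j) (∑ j ∈ t, star (u N j) * u N j)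
    linarith
  obtain ⟨v, hv⟩ : ∃ v : StandardModule A J, ∀ j, v j = g j := ⟨⟨g, hsum⟩, fun _ => rfl⟩
  simp only [← hv] at key
  refine ⟨v, Metric.tendsto_atTop.2 fun ε hε => ?_⟩
  obtain ⟨N, hN⟩ := key ((ε / 2) ^ 2) (by positivity)
  refine ⟨N, fun n hn => ?_⟩
  rw [dist_eq_norm]
  refine lt_of_le_of_lt (le_of_sq_le_sq ?_ (by positivity)) (half_lt_self hε)
  rw [norm_sq_eq_tsum]
  exact le_of_tendsto (summable_inner (u n - v) (u n - v)).hasSum.norm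
    (Filter.Eventually.of_forall fun s => hN n hn s)

end StandardModule

end StandardModule

/-!
## The universal enveloping von Neumann algebra
-/

section Ultraweak

variable (H : Type*) [NormedAddCommGroup H] [InnerProductSpace ℂ H]

/-- The ultraweak operator topology on `B(H)`: the coarsest topology for which the functionals
`T ↦ ∑ₙ ⟪ξₙ, T ηₙ⟫`, with `∑ₙ ‖ξₙ‖² < ∞` and `∑ₙ ‖ηₙ‖² < ∞`, are continuous. -/
@[reducible] noncomputable def ultraweakTopology : TopologicalSpace (H →L[ℂ] H) :=
  ⨅ p : lp (fun _ : ℕ => H) 2 × lp (fun _ : ℕ => H) 2,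
    TopologicalSpace.induced (fun T : H →L[ℂ] H => ∑' n, ⟪p.1 n, T (p.2 n)⟫_ℂ) inferInstance

end Ultraweak

section DirectSum

variable {ι : Type*} {G : ι → Type*} [∀ i, NormedAddCommGroup (G i)]
  [∀ i, InnerProductSpace ℂ (G i)]

/-- The direct sum of a bounded family of operators, acting on the Hilbert space direct sum. -/
noncomputable def lpDiagonal (T : ∀ i, G i →L[ℂ] G i) (C : ℝ) (hT : ∀ i, ‖T i‖ ≤ C) :
    lp G 2 →L[ℂ] lp G 2 :=
  LinearMap.mkContinuous
    { toFun := fun x => ⟨fun i => T i (x i), ((lp.memℓp x).norm.const_mul C).mono fun i =>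
        ((T i).le_opNorm (x i)).trans (mul_le_mul_of_nonneg_right (hT i) (norm_nonneg _))⟩
      map_add' := fun x y => by ext i; exact map_add (T i) (x i) (y i)
      map_smul' := fun c x => by ext i; exact map_smul (T i) c (x i) }
    C (fun x => by
      by_cases hι : Nonempty ι
      · have hC : 0 ≤ C := (norm_nonneg _).trans (hT hι.some)
        refine lp.norm_le_of_forall_sum_le (by simp) (by positivity) fun s => ?_
        simp only [ENNReal.toReal_ofNat, Real.rpow_two, mul_pow]
        refine le_trans ?_ (mul_le_mul_of_nonneg_left
          (by simpa using lp.sum_rpow_le_norm_rpow (p := 2) (by simp) x s) (sq_nonneg C))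
        rw [Finset.mul_sum]
        refine Finset.sum_le_sum fun i _ => ?_
        rw [← mul_pow]
        exact pow_le_pow_left₀ (norm_nonneg _) (((T i).le_opNorm (x i)).trans
          (mul_le_mul_of_nonneg_right (hT i) (norm_nonneg _))) 2
      · have : IsEmpty ι := not_nonempty_iff.1 hι
        have h (y : lp G 2) : y = 0 := by ext i; exact isEmptyElim i
        refine le_of_eq ((congrArg norm (h _)).trans ?_)
        rw [h x]
        simp)

@[simp] theorem lpDiagonal_apply (T : ∀ i, G i →L[ℂ] G i) (C : ℝ) (hT : ∀ i, ‖T i‖ ≤ C)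
    (x : lp G 2) (i : ι) : lpDiagonal T C hT x i = T i (x i) := rfl

end DirectSum

section UniversalRepresentation

variable (A : Type*) [CStarAlgebra A] [PartialOrder A]

/-- The states of `A`. -/
def CStarState : Type _ := {φ : A →ₚ[ℂ] ℂ // φ 1 = 1}

variable [StarOrderedRing A]

/-- The Hilbert space of the universal representation: the direct sum of the GNS spaces of all
states. -/
abbrev UniversalSpace : Type _ := lp (fun φ : CStarState A => φ.1.GNS) 2

/-- The universal representation: the direct sum of the GNS representations of all states. -/
noncomputable def universalRep : A →⋆ₐ[ℂ] (UniversalSpace A →L[ℂ] UniversalSpace A) where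
  toFun a := lpDiagonal (fun φ : CStarState A => φ.1.gnsStarAlgHom a) ‖a‖ fun φ =>
    NonUnitalStarAlgHom.norm_apply_le φ.1.gnsStarAlgHom a
  map_one' := by ext x φ; simp
  map_mul' a b := by ext x φ; simp
  map_zero' := by ext x φ; simp
  map_add' a b := by ext x φ; simp
  commutes' c := by ext x φ; simp [Algebra.algebraMap_eq_smul_one]
  map_star' a := by
    rw [ContinuousLinearMap.star_eq_adjoint, ContinuousLinearMap.eq_adjoint_iff]
    intro x y
    rw [lp.inner_eq_tsum, lp.inner_eq_tsum]
    refine tsum_congr fun φ => ?_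
    rw [lpDiagonal_apply, lpDiagonal_apply, map_star, ContinuousLinearMap.star_eq_adjoint,
      ContinuousLinearMap.adjoint_inner_left]

/-- The universal enveloping von Neumann algebra `A**` of `A`: the bicommutant of the image of the
universal representation. -/
noncomputable def envelopingVonNeumannAlgebra : VonNeumannAlgebra (UniversalSpace A) where
  toStarSubalgebra := StarSubalgebra.centralizer ℂ
    (Set.centralizer (Set.range (universalRep A)))
  centralizer_centralizer' := by
    change Set.centralizer (Set.centralizer (Set.centralizer _)) = Set.centralizer _
    rw [Set.centralizer_centralizer_centralizer]

theorem mem_envelopingVonNeumannAlgebra {T : UniversalSpace A →L[ℂ] UniversalSpace A} :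
    T ∈ envelopingVonNeumannAlgebra A ↔
      T ∈ Set.centralizer (Set.centralizer (Set.range (universalRep A))) := by
  change T ∈ Set.centralizer (_ ∪ star _) ↔ _
  rw [Set.union_eq_left.2]
  intro S hS R hR
  obtain ⟨a, rfl⟩ := hR
  have h := hS (universalRep A (star a)) ⟨star a, rfl⟩
  rw [map_star] at h
  have h' := congrArg star h
  simp only [star_mul, star_star] at h'
  exact h'.symm

end UniversalRepresentation

/-!
## Frames
-/

section Frame

variable (A : Type u) [CommCStarAlgebra A] [PartialOrder A] [StarOrderedRing A]
  {X : Type*} [NormedAddCommGroup X] [NormedSpace ℂ X] [Module A X] [CStarModule A X]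

/-- The family `(x j)` is a frame of the Hilbert `A`-module `X`: for some real `C > 0` and every
`y` in `X`, the sum `∑ ⟨y, x j⟩⟨x j, y⟩` converges ultraweakly to an element `S` of the universal
enveloping von Neumann algebra of `A`, and `C ⟨y, y⟩ ≤ S ≤ C⁻¹ ⟨y, y⟩` there. -/
def IsFrame {J : Type*} (x : J → X) : Prop :=
  ∃ C : ℝ, 0 < C ∧ ∀ y : X, ∃ S ∈ envelopingVonNeumannAlgebra A,
    Filter.Tendsto
      (fun F : Finset J => ∑ j ∈ F, universalRep A (inner A y (x j) * inner A (x j) y))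
      Filter.atTop (@nhds _ (ultraweakTopology (UniversalSpace A)) S) ∧
    universalRep A (C • inner A y y) ≤ S ∧ S ≤ universalRep A (C⁻¹ • inner A y y)

/-- A standard frame: a frame such that the sums `∑ ⟨y, x j⟩⟨x j, y⟩` converge in norm. -/
def IsStandardFrame {J : Type*} (x : J → X) : Prop :=
  IsFrame A x ∧ ∀ y : X, Summable fun j => (inner A y (x j) * inner A (x j) y : A)

end Frame

/-! If `A` is finite-dimensional, it is a finite sum of copies of ℂ, one for each character. A
Hilbert module is then the sum of its fibers, which are Hilbert spaces, and is determined by their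
dimensions (`hilbertModuleIso_of_fiber`). A standard module on a large infinite index set has fibers
big enough to absorb those of `X`. Conversely, a summand of a standard module inherits a Parseval
frame by projecting the unit vectors (`HilbertModuleIso.exists_isStandardFrame`).

If `A` is infinite-dimensional, its spectrum is infinite and carries a continuous `f ≥ 0` that is
positive along a sequence and zero at a limit point `z` of it. Each binary sequence `s` gives a path
of unit vectors `branch s t`: for fixed `t > 0` there are finitely many of them, at `t = 0`
uncountably many, all orthonormal, and yet all mutual inner products are continuous in `t`
(`inner_branch_of_ne`). Pulled back along `f`, the branches generate a Hilbert module of sections.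

A frame restricts to a scalar frame inequality at each character
(`IsFrame.exists_hasSum_character`). Where `f > 0` only countably many frame members are nonzero, so
by continuity only countably many are nonzero at `z`. These pair nontrivially with only countably
many of the uncountably many basis vectors at `z`, against the lower frame bound
(`not_isFrame_sections`). -/

open WeakDual Topology

/-! ### Ultraweak convergence tested on vectors -/

section UltraweakEvaluation

variable {H : Type*} [NormedAddCommGroup H] [InnerProductSpace ℂ H]

theorem tendsto_ultraweakTopology_iff {α : Type*} {l : Filter α} {T : α → H →L[ℂ] H}
    {S : H →L[ℂ] H} :
    Filter.Tendsto T l (@nhds _ (ultraweakTopology H) S) ↔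
      ∀ p : lp (fun _ : ℕ => H) 2 × lp (fun _ : ℕ => H) 2,
        Filter.Tendsto (fun a => ∑' n, ⟪p.1 n, T a (p.2 n)⟫_ℂ) l
          (nhds (∑' n, ⟪p.1 n, S (p.2 n)⟫_ℂ)) := by
  rw [ultraweakTopology, nhds_iInf, Filter.tendsto_iInf]
  refine forall_congr' fun p => ?_
  rw [nhds_induced, Filter.tendsto_comap_iff]
  rfl

/-- Sequences supported at the index `0` turn the defining functionals into vector functionals. -/
theorem tendsto_inner_of_tendsto_ultraweak {α : Type*} {l : Filter α} {T : α → H →L[ℂ] H}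
    {S : H →L[ℂ] H} (h : Filter.Tendsto T l (@nhds _ (ultraweakTopology H) S)) (ξ : H) :
    Filter.Tendsto (fun a => ⟪ξ, T a ξ⟫_ℂ) l (nhds ⟪ξ, S ξ⟫_ℂ) := by
  have key (R : H →L[ℂ] H) :
      ∑' n, ⟪(lp.single 2 0 ξ : lp (fun _ : ℕ => H) 2) n,
        R ((lp.single 2 0 ξ : lp (fun _ : ℕ => H) 2) n)⟫_ℂ = ⟪ξ, R ξ⟫_ℂ := by
    rw [tsum_eq_single 0]
    · simp
    · intro n hn
      rw [lp.single_apply_ne _ _ _ hn]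
      simp
  simpa only [key] using
    tendsto_ultraweakTopology_iff.1 h (lp.single 2 0 ξ, lp.single 2 0 ξ)

/-- Each defining functional is norm-bounded, with bound `∑ ‖ξₙ‖ ‖ηₙ‖`, finite by Hölder. -/
theorem tendsto_ultraweak_of_tendsto {α : Type*} {l : Filter α} {T : α → H →L[ℂ] H}
    {S : H →L[ℂ] H} (h : Filter.Tendsto T l (nhds S)) :
    Filter.Tendsto T l (@nhds _ (ultraweakTopology H) S) := by
  refine tendsto_ultraweakTopology_iff.2 fun p => ?_
  have hp : Summable fun n => ‖p.1 n‖ * ‖p.2 n‖ := by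
    have h2 (f : lp (fun _ : ℕ => H) 2) : Summable fun n => ‖f n‖ ^ (2 : ℝ) := by
      simpa using (lp.memℓp f).summable (by simp)
    exact Real.summable_mul_of_Lp_Lq_of_nonneg .two_two (fun _ => norm_nonneg _)
      (fun _ => norm_nonneg _) (h2 _) (h2 _)
  have hb (R : H →L[ℂ] H) (n : ℕ) : ‖⟪p.1 n, R (p.2 n)⟫_ℂ‖ ≤ ‖R‖ * (‖p.1 n‖ * ‖p.2 n‖) := by
    refine (norm_inner_le_norm _ _).trans ?_
    rw [mul_left_comm]
    exact mul_le_mul_of_nonneg_left (R.le_opNorm _) (norm_nonneg _)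
  have hs (R : H →L[ℂ] H) : Summable fun n => ⟪p.1 n, R (p.2 n)⟫_ℂ :=
    .of_norm_bounded (hp.mul_left ‖R‖) (hb R)
  rw [tendsto_iff_norm_sub_tendsto_zero]
  refine squeeze_zero (g := fun a => ‖T a - S‖ * ∑' n, ‖p.1 n‖ * ‖p.2 n‖)
    (fun _ => norm_nonneg _) (fun a => ?_) ?_
  · rw [← (hs _).tsum_sub (hs _), ← tsum_mul_left]
    refine tsum_of_norm_bounded (hp.mul_left _).hasSum fun n => ?_
    rw [← inner_sub_right]
    exact hb (T a - S) n
  · simpa using (tendsto_iff_norm_sub_tendsto_zero.1 h).mul_const (∑' n, ‖p.1 n‖ * ‖p.2 n‖)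

end UltraweakEvaluation

/-! ### Characters as vector states, and frames at a character -/

section Characters

variable {A : Type u} [CommCStarAlgebra A] [PartialOrder A] [StarOrderedRing A]

/-- A character of `A`, as a state. -/
noncomputable def characterState (z : characterSpace ℂ A) : CStarState A :=
  ⟨PositiveLinearMap.mk₀ (CharacterSpace.toAlgHom z).toLinearMap fun a ha => by
    simpa using OrderHomClass.mono z ha, by
    change z 1 = 1
    simp⟩

/-- The cyclic vector of a state, in the universal representation. -/
noncomputable def cyclicVector (φ : CStarState A) : UniversalSpace A := by
  classical
  exact lp.single 2 φ ((φ.1.toPreGNS 1 : φ.1.PreGNS) : φ.1.GNS)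

/-- Every state becomes a vector state, so limits and inequalities in the enveloping algebra can be
read at a character even when the limit does not come from `A`. -/
theorem inner_cyclicVector_universalRep (φ : CStarState A) (a : A) :
    ⟪cyclicVector φ, universalRep A a (cyclicVector φ)⟫_ℂ = φ.1 a := by
  classical
  rw [cyclicVector, lp.inner_single_left]
  simp [universalRep, PositiveLinearMap.preGNS_inner_def]

end Characters

section FrameEvaluation

variable {A : Type u} [CommCStarAlgebra A] [PartialOrder A] [StarOrderedRing A]
  {X : Type*} [NormedAddCommGroup X] [NormedSpace ℂ X] [Module A X] [CStarModule A X]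

omit [StarOrderedRing A] in
theorem character_inner_mul_inner (z : characterSpace ℂ A) (x y : X) :
    z (inner A y x * inner A x y) = ((‖z (inner A x y)‖ ^ 2 : ℝ) : ℂ) := by
  rw [map_mul, ← CStarModule.star_inner x y, map_star, RCLike.star_def, Complex.conj_mul']
  simp

theorem re_inner_cyclicVector_mono (φ : CStarState A)
    {S T : UniversalSpace A →L[ℂ] UniversalSpace A} (h : S ≤ T) :
    (⟪cyclicVector φ, S (cyclicVector φ)⟫_ℂ).re ≤ (⟪cyclicVector φ, T (cyclicVector φ)⟫_ℂ).re := by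
  have := (ContinuousLinearMap.le_def S T).1 h
  have := this.inner_nonneg_right (cyclicVector φ)
  rw [sub_apply, inner_sub_right] at this
  have := (Complex.le_def.1 this).1
  simpa using this

/-- A frame gives, at each character, a scalar frame inequality. -/
theorem IsFrame.exists_hasSum_character {J : Type*} {x : J → X} (hx : IsFrame A x) :
    ∃ C : ℝ, 0 < C ∧ ∀ (y : X) (z : characterSpace ℂ A), ∃ r : ℝ,
      HasSum (fun j => ‖z (inner A (x j) y)‖ ^ 2) r ∧ C * (z (inner A y y)).re ≤ r := by
  obtain ⟨C, hC, h⟩ := hx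
  refine ⟨C, hC, fun y z => ?_⟩
  obtain ⟨S, -, hS, hl, -⟩ := h y
  let φ := characterState z
  refine ⟨(⟪cyclicVector φ, S (cyclicVector φ)⟫_ℂ).re, ?_, ?_⟩
  · have h1 := (Complex.continuous_re.tendsto _).comp
      (tendsto_inner_of_tendsto_ultraweak hS (cyclicVector φ))
    refine h1.congr fun F => ?_
    rw [Function.comp_apply, ← map_sum, inner_cyclicVector_universalRep, map_sum, Complex.re_sum]
    refine Finset.sum_congr rfl fun j _ => ?_
    change (z _).re = _
    rw [character_inner_mul_inner, Complex.ofReal_re]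
  · have h2 := re_inner_cyclicVector_mono φ hl
    rw [inner_cyclicVector_universalRep] at h2
    refine le_trans (le_of_eq ?_) h2
    change _ = (z _).re
    rw [← Complex.coe_smul, map_smul]
    simp

/-- A family satisfying Parseval's identity in norm is a standard frame. -/
theorem isStandardFrame_of_hasSum {J : Type*} {x : J → X}
    (h : ∀ y : X, HasSum (fun j => (inner A y (x j) * inner A (x j) y : A)) (inner A y y)) :
    IsStandardFrame A x := by
  -- The limit is the image of `⟨y, y⟩` itself, so both bounds are equalities with `C = 1`.
  refine ⟨⟨1, one_pos, fun y => ⟨universalRep A (inner A y y), ?_, ?_, ?_, ?_⟩⟩,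
    fun y => (h y).summable⟩
  · exact mem_envelopingVonNeumannAlgebra A |>.2 (Set.subset_centralizer_centralizer ⟨_, rfl⟩)
  · refine tendsto_ultraweak_of_tendsto ?_
    have hc : Continuous (universalRep A) :=
      AddMonoidHomClass.continuous_of_bound (universalRep A) 1 fun a => by
        rw [one_mul]
        exact NonUnitalStarAlgHom.norm_apply_le (universalRep A).toNonUnitalStarAlgHom a
    simpa [Function.comp_def, HasSum] using (hc.tendsto _).comp (h y)
  · simp
  · simp

end FrameEvaluation

/-! ### Summands of standard modules -/

namespace StandardModule

variable {A : Type*} [CommCStarAlgebra A] [PartialOrder A] [StarOrderedRing A] {J : Type*}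

theorem ext {f g : StandardModule A J} (h : ∀ j, f j = g j) : f = g := Subtype.ext (funext h)

variable [DecidableEq J]

/-- The family with the single nonzero entry `a`, at `j`. -/
def single (j : J) (a : A) : StandardModule A J :=
  ⟨Pi.single j a, summable_of_ne_finset_zero (s := {j}) fun i hi => by
    simp [Pi.single_eq_of_ne (Finset.notMem_singleton.1 hi)]⟩

theorem single_apply (j : J) (a : A) (i : J) :
    single j a i = (Pi.single j a : J → A) i := rfl

theorem inner_single_left (j : J) (a : A) (f : StandardModule A J) :
    inner A (single j a) f = star a * f j := by
  rw [inner_def, tsum_eq_single j fun i hi => by simp [single_apply, Pi.single_eq_of_ne hi]]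
  simp [single_apply]

end StandardModule

section Summand

variable {A : Type u} [CommCStarAlgebra A] [PartialOrder A] [StarOrderedRing A]
  {X : Type*} [NormedAddCommGroup X] [NormedSpace ℂ X] [Module A X] [CStarModule A X]
  {Y : Type*} [NormedAddCommGroup Y] [NormedSpace ℂ Y] [Module A Y] [CStarModule A Y]

/-- A direct summand of a standard module has a standard frame. -/
theorem HilbertModuleIso.exists_isStandardFrame {J : Type*}
    (h : HilbertModuleIso A C⋆ᵐᵒᵈ(A, X × Y) (StandardModule A J)) :
    ∃ x : J → X, IsStandardFrame A x := by
  classical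
  obtain ⟨e, he⟩ := h
  -- The `X`-components of the preimages of the unit vectors: pairing them with `y` gives the
  -- coordinates of `e (y, 0)`, whose squares sum to `⟨y, y⟩`.
  refine ⟨fun j => (e.symm (StandardModule.single j 1)).1, isStandardFrame_of_hasSum fun y => ?_⟩
  let v : C⋆ᵐᵒᵈ(A, X × Y) := (WithCStarModule.equiv A (X × Y)).symm (y, 0)
  have hv (w : C⋆ᵐᵒᵈ(A, X × Y)) : inner A w v = inner A w.1 y := by
    rw [WithCStarModule.prod_inner]
    simp [v]
  have hx (j : J) : inner A (e.symm (StandardModule.single j 1)).1 y = e v j := by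
    rw [← hv, ← he, e.apply_symm_apply, StandardModule.inner_single_left, star_one, one_mul]
  have hs := (StandardModule.summable_inner (e v) (e v)).hasSum
  rw [← StandardModule.inner_def, he, hv] at hs
  refine hs.congr_fun fun j => ?_
  rw [← hx, CStarModule.star_inner]

end Summand

/-! ### Fibers of a Hilbert module at characters -/

theorem character_ext {A : Type*} [CommCStarAlgebra A] {a b : A}
    (h : ∀ z : characterSpace ℂ A, z a = z b) : a = b :=
  (gelfandStarTransform A).injective (ContinuousMap.ext h)

section ModuleLemmas

variable {A : Type*} [CommCStarAlgebra A] [PartialOrder A] [StarOrderedRing A]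
  {X : Type*} [NormedAddCommGroup X] [NormedSpace ℂ X] [Module A X] [CStarModule A X]

namespace CStarModule

variable (A) in
omit [StarOrderedRing A] in
theorem ext_inner {x y : X} (h : ∀ w : X, inner A w x = inner A w y) : x = y := by
  rw [← sub_eq_zero, ← inner_self (A := A), inner_sub_right, h, sub_self]

-- The actions of `A` and of ℂ are given independently; definiteness of the inner product forces
-- them to be compatible.
omit [StarOrderedRing A] in
theorem smul_smul_complex (a : A) (c : ℂ) (x : X) : a • c • x = c • a • x :=
  ext_inner A fun w => by
    rw [inner_op_smul_right, inner_smul_right_complex, inner_smul_right_complex,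
      inner_op_smul_right, mul_smul_comm]

omit [StarOrderedRing A] in
theorem smul_complex_smul (c : ℂ) (a : A) (x : X) : (c • a) • x = c • a • x :=
  ext_inner A fun w => by
    rw [inner_op_smul_right, inner_smul_right_complex, inner_op_smul_right, smul_mul_assoc]

omit [StarOrderedRing A] in
theorem norm_op_smul_le (a : A) (x : X) : ‖a • x‖ ≤ ‖a‖ * ‖x‖ := by
  refine le_of_sq_le_sq ?_ (by positivity)
  rw [norm_sq_eq A, inner_op_smul_left, inner_op_smul_right, mul_pow, norm_sq_eq A (x := x)]
  refine (norm_mul_le _ _).trans ?_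
  rw [norm_star]
  nlinarith [norm_mul_le a (inner A x x), norm_nonneg a]

omit [StarOrderedRing A] in
theorem continuous_op_smul (a : A) : Continuous fun x : X => a • x :=
  AddMonoidHomClass.continuous_of_bound (DistribSMul.toAddMonoidHom X a) ‖a‖ (norm_op_smul_le a)

end CStarModule

variable (X) in
/-- The fiber of a Hilbert module at a character `z`: the elements on which every `a` acts as the
scalar `z a`. -/
def characterFiber (z : characterSpace ℂ A) : Submodule ℂ X where
  carrier := {x | ∀ a : A, a • x = z a • x}
  zero_mem' a := by simp
  add_mem' hx hy a := by rw [smul_add, smul_add, hx a, hy a]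
  smul_mem' c x hx a := by rw [CStarModule.smul_smul_complex, hx a, smul_comm]

namespace characterFiber

omit [StarOrderedRing A] in
theorem isClosed (z : characterSpace ℂ A) : IsClosed (characterFiber X z : Set X) := by
  change IsClosed {x : X | ∀ a : A, a • x = z a • x}
  rw [Set.ofPred_forall]
  exact isClosed_iInter fun a =>
    isClosed_eq (CStarModule.continuous_op_smul a) (continuous_const_smul _)

instance [CompleteSpace X] (z : characterSpace ℂ A) : CompleteSpace (characterFiber X z) :=
  (isClosed z).completeSpace_coe

-- The self-adjoint `b = ⟨x, x⟩` satisfies `b² = z(b) b`, so the C⋆-identity gives `‖b‖ = |z(b)|`.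
-- Thus the module norm on a fiber is already a Hilbert space norm.
omit [StarOrderedRing A] in
theorem norm_sq_eq {z : characterSpace ℂ A} {x : X} (hx : x ∈ characterFiber X z) :
    ‖x‖ ^ 2 = ‖z (inner A x x)‖ := by
  rw [CStarModule.norm_sq_eq A]
  set b : A := inner A x x with hb
  have h : b * b = z b • b := by
    nth_rw 2 [hb]
    rw [← CStarModule.inner_op_smul_right, hx b, CStarModule.inner_smul_right_complex]
  have hs : star b = b := CStarModule.star_inner x x
  have h' := CStarRing.norm_star_mul_self (x := b)
  rw [hs, h, norm_smul] at h'
  rcases eq_or_ne b 0 with h0 | h0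
  · simp [h0]
  · exact (mul_right_cancel₀ (norm_ne_zero_iff.2 h0) h').symm

noncomputable instance (z : characterSpace ℂ A) : InnerProductSpace ℂ (characterFiber X z) where
  inner x y := z (inner A (x : X) (y : X))
  norm_sq_eq_re_inner x := by
    have h0 : 0 ≤ z (inner A (x : X) (x : X)) := by
      simpa using OrderHomClass.mono z (CStarModule.inner_self_nonneg (A := A) (x := (x : X)))
    change ‖(x : X)‖ ^ 2 = _
    rw [norm_sq_eq x.2]
    have h1 := congrArg Complex.re (Complex.norm_of_nonneg' h0)
    rwa [Complex.ofReal_re] at h1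
  conj_inner_symm x y := by
    rw [← RCLike.star_def, ← map_star, CStarModule.star_inner]
  add_left x y w := by simp
  smul_left x y c := by simp

theorem inner_def {z : characterSpace ℂ A} (x y : characterFiber X z) :
    ⟪x, y⟫_ℂ = z (inner A (x : X) (y : X)) := rfl

end characterFiber

end ModuleLemmas

/-! ### Finite spectrum: minimal projections and gluing of fibers -/

section FiniteSpectrum

variable (A : Type u) [CommCStarAlgebra A]

instance [FiniteDimensional ℂ A] : Finite (characterSpace ℂ A) :=
  Finite.of_injective (fun z : characterSpace ℂ A => CharacterSpace.toAlgHom z) fun _ _ h =>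
    CharacterSpace.ext fun a => DFunLike.congr_fun h a

/-- If the character space is finite, then so is the dimension. -/
theorem finiteDimensional_of_finite_characterSpace [Finite (characterSpace ℂ A)] :
    FiniteDimensional ℂ A := by
  let f : A →ₗ[ℂ] (characterSpace ℂ A → ℂ) :=
    LinearMap.pi fun z => (CharacterSpace.toAlgHom z).toLinearMap
  exact FiniteDimensional.of_injective f fun a b h => character_ext fun z => congrFun h z

variable {A} [Finite (characterSpace ℂ A)]

open Classical in
/-- The minimal projection of a finite-dimensional algebra that belongs to a character. -/
noncomputable def minimalProjection (z : characterSpace ℂ A) : A :=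
  (gelfandStarTransform A).symm ⟨Pi.single z 1, continuous_of_discreteTopology⟩

open Classical in
theorem apply_minimalProjection (w z : characterSpace ℂ A) :
    w (minimalProjection z) = if w = z then 1 else 0 := by
  have h : gelfandStarTransform A (minimalProjection z) w = (Pi.single z 1 : _ → ℂ) w := by
    rw [minimalProjection, (gelfandStarTransform A).apply_symm_apply]
    rfl
  rw [Pi.single_apply] at h
  exact h

theorem mul_minimalProjection (z : characterSpace ℂ A) (a : A) :
    a * minimalProjection z = z a • minimalProjection z := by
  classical
  refine character_ext fun w => ?_
  rw [map_mul, map_smul, apply_minimalProjection]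
  split_ifs with h
  · subst h; rfl
  · simp

theorem star_minimalProjection (z : characterSpace ℂ A) :
    star (minimalProjection z) = minimalProjection z := by
  classical
  refine character_ext fun w => ?_
  rw [map_star, apply_minimalProjection]
  split_ifs <;> simp

theorem sum_minimalProjection [Fintype (characterSpace ℂ A)] :
    ∑ z : characterSpace ℂ A, minimalProjection z = 1 := by
  classical
  refine character_ext fun w => ?_
  simp [map_sum, apply_minimalProjection]

end FiniteSpectrum

section Gluing

variable {A : Type u} [CommCStarAlgebra A] [PartialOrder A] [StarOrderedRing A]
  [Finite (characterSpace ℂ A)]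
  {X : Type*} [NormedAddCommGroup X] [NormedSpace ℂ X] [Module A X] [CStarModule A X]
  {Y : Type*} [NormedAddCommGroup Y] [NormedSpace ℂ Y] [Module A Y] [CStarModule A Y]

namespace characterFiber

variable (X) in
/-- The projection of a Hilbert module over a finite-dimensional algebra onto a fiber. -/
noncomputable def proj (z : characterSpace ℂ A) : X →ₗ[ℂ] characterFiber X z where
  toFun x := ⟨minimalProjection z • x, fun a => by
    rw [smul_smul, mul_minimalProjection, CStarModule.smul_complex_smul]⟩
  map_add' x y := Subtype.ext (smul_add _ x y)
  map_smul' c x := Subtype.ext (CStarModule.smul_smul_complex _ c x)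

omit [StarOrderedRing A] in
theorem coe_proj (z : characterSpace ℂ A) (x : X) :
    (proj X z x : X) = minimalProjection z • x := rfl

omit [StarOrderedRing A] in
theorem proj_smul (z : characterSpace ℂ A) (a : A) (x : X) :
    proj X z (a • x) = z a • proj X z x := by
  refine Subtype.ext ?_
  rw [coe_proj, Submodule.coe_smul, coe_proj, smul_smul, mul_comm, mul_minimalProjection,
    CStarModule.smul_complex_smul]

omit [StarOrderedRing A] in
theorem sum_proj [Fintype (characterSpace ℂ A)] (x : X) :
    ∑ z : characterSpace ℂ A, (proj X z x : X) = x := by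
  simp only [coe_proj]
  rw [← Finset.sum_smul, sum_minimalProjection, one_smul]

omit [StarOrderedRing A] in
theorem proj_coe_self (z : characterSpace ℂ A) (u : characterFiber X z) : proj X z (u : X) = u := by
  classical
  refine Subtype.ext ?_
  rw [coe_proj, u.2, apply_minimalProjection, if_pos rfl, one_smul]

omit [StarOrderedRing A] in
theorem proj_coe_of_ne {w z : characterSpace ℂ A} (h : z ≠ w) (u : characterFiber X z) :
    proj X w (u : X) = 0 := by
  classical
  refine Subtype.ext ?_
  rw [coe_proj, u.2, apply_minimalProjection, if_neg h, zero_smul]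
  rfl

omit [StarOrderedRing A] in
theorem proj_sum [Fintype (characterSpace ℂ A)] (u : ∀ z : characterSpace ℂ A, characterFiber X z)
    (w : characterSpace ℂ A) : proj X w (∑ z, (u z : X)) = u w := by
  rw [map_sum, Finset.sum_eq_single w, proj_coe_self]
  · exact fun z _ h => proj_coe_of_ne h _
  · simp

/-- The projection is self-adjoint with value `1` at `z`. The fiber components therefore determine
the whole `A`-valued inner product. -/
theorem inner_proj (z : characterSpace ℂ A) (x y : X) :
    ⟪proj X z x, proj X z y⟫_ℂ = z (inner A x y) := by
  classical
  rw [inner_def, coe_proj, coe_proj, CStarModule.inner_op_smul_left,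
    CStarModule.inner_op_smul_right, star_minimalProjection, map_mul, map_mul,
    apply_minimalProjection, if_pos rfl, one_mul, mul_one]

end characterFiber

open characterFiber

/-- Over a finite-dimensional algebra, Hilbert modules with isometric fibers are isomorphic. -/
theorem hilbertModuleIso_of_fiber
    (h : ∀ z : characterSpace ℂ A, Nonempty (characterFiber X z ≃ₗᵢ[ℂ] characterFiber Y z)) :
    HilbertModuleIso A X Y := by
  have := Fintype.ofFinite (characterSpace ℂ A)
  let U z := (h z).some
  let e : X ≃ₗ[A] Y :=
    { toFun := fun x => ∑ z, (U z (proj X z x) : Y)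
      invFun := fun y => ∑ z, ((U z).symm (proj Y z y) : X)
      map_add' := fun x y => by simp [Finset.sum_add_distrib]
      map_smul' := fun a x => by
        rw [RingHom.id_apply, Finset.smul_sum]
        refine Finset.sum_congr rfl fun z _ => ?_
        rw [proj_smul, map_smul, (U z (proj X z x)).2 a]
        rfl
      left_inv := fun x => by
        simp only [proj_sum, LinearIsometryEquiv.symm_apply_apply, sum_proj]
      right_inv := fun y => by
        simp only [proj_sum, LinearIsometryEquiv.apply_symm_apply, sum_proj] }
  -- The fibers are independent, so `e` acts on each component by `U z` alone and isometry can be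
  -- checked one character at a time.
  have he (x : X) (z : characterSpace ℂ A) : proj Y z (e x) = U z (proj X z x) :=
    proj_sum (fun z => U z (proj X z x)) z
  refine ⟨e, fun x y => character_ext fun z => ?_⟩
  rw [← inner_proj, he, he, LinearIsometryEquiv.inner_map_map, inner_proj]

end Gluing

/-! ### Absorption over a finite-dimensional algebra -/

section Pairs

variable {A : Type u} [CommCStarAlgebra A] [PartialOrder A] [StarOrderedRing A]
  {X : Type*} [NormedAddCommGroup X] [NormedSpace ℂ X] [Module A X] [CStarModule A X]
  {Y : Type*} [NormedAddCommGroup Y] [NormedSpace ℂ Y] [Module A Y] [CStarModule A Y]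

/-- The fiber of a direct sum contains the direct sum of the fibers. -/
def fiberPair (z : characterSpace ℂ A) (x : characterFiber X z) (y : characterFiber Y z) :
    characterFiber C⋆ᵐᵒᵈ(A, X × Y) z :=
  ⟨(WithCStarModule.equiv A (X × Y)).symm (x, y), fun a => Prod.ext (x.2 a) (y.2 a)⟩

theorem inner_fiberPair (z : characterSpace ℂ A) (x x' : characterFiber X z)
    (y y' : characterFiber Y z) :
    ⟪fiberPair z x y, fiberPair z x' y'⟫_ℂ = ⟪x, x'⟫_ℂ + ⟪y, y'⟫_ℂ :=
  map_add z _ _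

theorem exists_eq_fiberPair (z : characterSpace ℂ A) (v : characterFiber C⋆ᵐᵒᵈ(A, X × Y) z) :
    ∃ x y, v = fiberPair z x y :=
  ⟨⟨v.1.1, fun a => congrArg Prod.fst (v.2 a)⟩, ⟨v.1.2, fun a => congrArg Prod.snd (v.2 a)⟩, rfl⟩

end Pairs

section Absorption

variable {A : Type u} [CommCStarAlgebra A] [PartialOrder A] [StarOrderedRing A]
  [Finite (characterSpace ℂ A)]

open characterFiber

theorem Submodule.orthogonal_span_range_eq_bot {ι E : Type*} [NormedAddCommGroup E]
    [InnerProductSpace ℂ E] {v : ι → E} (h : ∀ x, (∀ i, ⟪v i, x⟫_ℂ = 0) → x = 0) :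
    (Submodule.span ℂ (Set.range v))ᗮ = ⊥ :=
  (Submodule.eq_bot_iff _).2 fun x hx => h x fun i =>
    hx _ (Submodule.subset_span ⟨i, rfl⟩)

theorem HilbertBasis.inner_eq_zero {ι E : Type*} [NormedAddCommGroup E]
    [InnerProductSpace ℂ E] (b : HilbertBasis ι ℂ E) {x : E} (h : ∀ i, ⟪b i, x⟫_ℂ = 0) : x = 0 := by
  refine b.repr.injective ?_
  ext i
  rw [b.repr_apply_apply, h, map_zero]
  rfl

open Classical in
/-- The element of the fiber of the standard module with the single nonzero entry at `j`. -/
noncomputable def fiberSingle {J : Type*} (z : characterSpace ℂ A) (j : J) :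
    characterFiber (StandardModule A J) z :=
  ⟨StandardModule.single j (minimalProjection z), fun a => StandardModule.ext fun i => by
    rw [StandardModule.smul_apply, StandardModule.complex_smul_apply, StandardModule.single_apply]
    rcases eq_or_ne i j with rfl | h
    · rw [Pi.single_eq_same, mul_minimalProjection]
    · rw [Pi.single_eq_of_ne h, mul_zero, smul_zero]⟩

theorem inner_fiberSingle {J : Type*} (z : characterSpace ℂ A) (j : J)
    (f : characterFiber (StandardModule A J) z) :
    ⟪fiberSingle z j, f⟫_ℂ = z ((f : StandardModule A J) j) := by
  classical
  rw [inner_def, fiberSingle, StandardModule.inner_single_left, star_minimalProjection, map_mul,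
    apply_minimalProjection, if_pos rfl, one_mul]

theorem orthonormal_fiberSingle {J : Type*} (z : characterSpace ℂ A) :
    Orthonormal ℂ (fiberSingle (J := J) z) := by
  classical
  rw [orthonormal_iff_ite]
  intro i j
  rw [inner_fiberSingle]
  change z ((Pi.single j (minimalProjection z) : J → A) i) = _
  rw [Pi.single_apply]
  split_ifs
  · rw [apply_minimalProjection, if_pos rfl]
  · exact map_zero z

/-- If `z` kills the coordinate `a = f j`, then `star a` acts on `f` as the scalar `0`; the `j`-th
coordinate of this says `star a * a = 0`. -/
theorem eq_zero_of_inner_fiberSingle {J : Type*} (z : characterSpace ℂ A)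
    {f : characterFiber (StandardModule A J) z} (h : ∀ j, ⟪fiberSingle z j, f⟫_ℂ = 0) : f = 0 := by
  refine Subtype.ext (StandardModule.ext fun j => ?_)
  have h1 := h j
  rw [inner_fiberSingle] at h1
  have h2 := congrArg (fun g : StandardModule A J => g j) (f.2 (star ((f : StandardModule A J) j)))
  simp only [StandardModule.smul_apply, map_star, h1, star_zero, zero_smul] at h2
  exact CStarRing.star_mul_self_eq_zero_iff _ |>.1 h2

variable {X : Type u} [NormedAddCommGroup X] [NormedSpace ℂ X] [Module A X] [CStarModule A X]
  [CompleteSpace X]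

variable (X) in
/-- Over a finite-dimensional algebra, every Hilbert module is absorbed by a standard module. -/
theorem exists_hilbertModuleIso_prod_standardModule :
    ∃ J : Type u, HilbertModuleIso A C⋆ᵐᵒᵈ(A, X × StandardModule A J) (StandardModule A J) := by
  -- The factor ℕ makes the index set infinite, and `X` makes it at least as large as a basis of any
  -- fiber, so one set serves all characters.
  refine ⟨ℕ × X, hilbertModuleIso_of_fiber fun z => ?_⟩
  obtain ⟨w, b, -⟩ := exists_hilbertBasis ℂ (characterFiber X z)
  obtain ⟨σ⟩ : Nonempty (w ⊕ (ℕ × X) ≃ ℕ × X) := by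
    rw [← Cardinal.eq, ← Cardinal.add_def]
    refine Cardinal.add_eq_right (Cardinal.infinite_iff.1 inferInstance) ?_
    exact Cardinal.mk_le_of_injective (f := fun i : w => (0, ((i : characterFiber X z) : X)))
      fun i j h => Subtype.ext (Subtype.ext (Prod.ext_iff.1 h).2)
  let v : w ⊕ (ℕ × X) → characterFiber C⋆ᵐᵒᵈ(A, X × StandardModule A (ℕ × X)) z :=
    Sum.elim (fun i => fiberPair z (b i) 0) fun j => fiberPair z 0 (fiberSingle z j)
  have hv : Orthonormal ℂ v := by
    classical
    have hb := orthonormal_iff_ite.1 b.orthonormal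
    have hs := orthonormal_iff_ite.1 (orthonormal_fiberSingle (A := A) (J := ℕ × X) z)
    rw [orthonormal_iff_ite]
    rintro (i | i) (j | j) <;> simp [v, inner_fiberPair, hb, hs]
  have hv0 (u) (h : ∀ i, ⟪v i, u⟫_ℂ = 0) : u = 0 := by
    obtain ⟨x, f, rfl⟩ := exists_eq_fiberPair z u
    have hx : x = 0 := b.inner_eq_zero fun i => by
      simpa [v, inner_fiberPair] using h (Sum.inl i)
    have hf : f = 0 := eq_zero_of_inner_fiberSingle z fun j => by
      simpa [v, inner_fiberPair] using h (Sum.inr j)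
    rw [hx, hf]
    rfl
  -- After reindexing by `σ`, both fibers have Hilbert bases indexed by `ℕ × X`, hence are isometric
  -- to the same ℓ² space.
  let b₁ := HilbertBasis.mkOfOrthogonalEqBot (hv.comp σ.symm σ.symm.injective)
    (Submodule.orthogonal_span_range_eq_bot fun u h => hv0 u fun i => by simpa using h (σ i))
  let b₂ := HilbertBasis.mkOfOrthogonalEqBot (orthonormal_fiberSingle (A := A) (J := ℕ × X) z)
    (Submodule.orthogonal_span_range_eq_bot fun u h => eq_zero_of_inner_fiberSingle z h)
  exact ⟨b₁.repr.trans b₂.repr.symm⟩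

end Absorption

/-! ### Continuous fields of vectors and their local approximations -/

/-- A space of vector fields `Z → H` with continuous mutual inner products. -/
structure VectorFieldSpace (Z H : Type*) [TopologicalSpace Z] [NormedAddCommGroup H]
    [InnerProductSpace ℂ H] where
  /-- The vector fields. -/
  fields : Submodule ℂ (Z → H)
  continuous_inner : ∀ v ∈ fields, ∀ w ∈ fields, Continuous fun z => ⟪v z, w z⟫_ℂ

namespace VectorFieldSpace

section Approximation

variable {Z H : Type*} [TopologicalSpace Z] [NormedAddCommGroup H] [InnerProductSpace ℂ H]

/-- A vector field is a section if it is locally a uniform limit of the given fields. -/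
def IsSection (F : VectorFieldSpace Z H) (ξ : Z → H) : Prop :=
  ∀ z₀, ∀ ε > 0, ∃ v ∈ F.fields, ∀ᶠ z in 𝓝 z₀, ‖ξ z - v z‖ < ε

variable {F : VectorFieldSpace Z H} {ξ η : Z → H}

theorem isSection_of_mem {v : Z → H} (hv : v ∈ F.fields) : F.IsSection v := fun _ ε hε =>
  ⟨v, hv, Filter.Eventually.of_forall fun _ => by simpa using hε⟩

theorem IsSection.add (hξ : F.IsSection ξ) (hη : F.IsSection η) : F.IsSection (ξ + η) := by
  intro z₀ ε hε
  obtain ⟨v, hv, hv'⟩ := hξ z₀ (ε / 2) (half_pos hε)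
  obtain ⟨w, hw, hw'⟩ := hη z₀ (ε / 2) (half_pos hε)
  refine ⟨v + w, F.fields.add_mem hv hw, ?_⟩
  filter_upwards [hv', hw'] with z h1 h2
  rw [Pi.add_apply, Pi.add_apply, add_sub_add_comm]
  exact (norm_add_le _ _).trans_lt (by linarith)

omit [TopologicalSpace Z] in
theorem norm_inner_self (v : Z → H) (z : Z) : ‖⟪v z, v z⟫_ℂ‖ = ‖v z‖ ^ 2 := by
  rw [inner_self_eq_norm_sq_to_K, norm_pow, RCLike.norm_ofReal, abs_norm]

theorem continuous_norm_of_continuous_inner {v : Z → H} (h : Continuous fun z => ⟪v z, v z⟫_ℂ) :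
    Continuous fun z => ‖v z‖ := by
  have h2 (z : Z) : ‖v z‖ = √‖⟪v z, v z⟫_ℂ‖ := by
    rw [norm_inner_self, Real.sqrt_sq (norm_nonneg _)]
  simp only [h2]
  exact h.norm.sqrt

theorem IsSection.eventually_norm_lt (hξ : F.IsSection ξ) (z₀ : Z) :
    ∃ M > 0, ∀ᶠ z in 𝓝 z₀, ‖ξ z‖ < M := by
  obtain ⟨v, hv, hv'⟩ := hξ z₀ 1 one_pos
  refine ⟨‖v z₀‖ + 1 + 1, by positivity, ?_⟩
  filter_upwards [hv', (continuous_norm_of_continuous_inner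
    (F.continuous_inner v hv v hv)).continuousAt.eventually_lt
    continuousAt_const (lt_add_one ‖v z₀‖)] with z h1 h2
  calc ‖ξ z‖ = ‖v z + (ξ z - v z)‖ := by rw [add_sub_cancel]
    _ ≤ ‖v z‖ + ‖ξ z - v z‖ := norm_add_le _ _
    _ < _ := add_lt_add h2 h1

/-- Since `ξ` is locally bounded, `g` may be frozen at `g z₀` near `z₀`; hence the given fields need
only be stable under constant multiples. -/
theorem IsSection.smul {g : Z → ℂ} (hg : Continuous g) (hξ : F.IsSection ξ) :
    F.IsSection fun z => g z • ξ z := by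
  intro z₀ ε hε
  obtain ⟨M, hM, hM'⟩ := hξ.eventually_norm_lt z₀
  -- The added `1` covers the case `g z₀ = 0`.
  obtain ⟨v, hv, hv'⟩ := hξ z₀ (ε / 2 / (‖g z₀‖ + 1)) (by positivity)
  refine ⟨g z₀ • v, F.fields.smul_mem _ hv, ?_⟩
  filter_upwards [hv', hM', (Metric.continuousAt_iff'.1 hg.continuousAt) (ε / 2 / M)
    (by positivity)] with z h1 h2 h3
  rw [dist_eq_norm] at h3
  have h4 : g z • ξ z - (g z₀ • v) z = (g z - g z₀) • ξ z + g z₀ • (ξ z - v z) := by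
    rw [Pi.smul_apply, sub_smul, smul_sub]
    abel
  rw [h4]
  refine (norm_add_le _ _).trans_lt ?_
  rw [norm_smul, norm_smul]
  have h5 : ‖g z - g z₀‖ * ‖ξ z‖ < ε / 2 := by
    rw [← div_mul_cancel₀ (ε / 2) hM.ne']
    exact mul_lt_mul'' h3 h2 (norm_nonneg _) (norm_nonneg _)
  have h6 : ‖g z₀‖ * ‖ξ z - v z‖ ≤ ε / 2 := by
    rw [← mul_div_cancel₀ (ε / 2) (show ‖g z₀‖ + 1 ≠ 0 by positivity)]
    exact mul_le_mul (by linarith) h1.le (norm_nonneg _) (by positivity)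
  linarith

/-- Near each point the function is a uniform limit of the continuous functions `⟪v, w⟫`. The field
`w` is chosen after `v`, since its accuracy depends on a bound for `v`. -/
theorem IsSection.continuous_inner (hξ : F.IsSection ξ) (hη : F.IsSection η) :
    Continuous fun z => ⟪ξ z, η z⟫_ℂ := by
  refine continuous_iff_continuousAt.2 fun z₀ => ?_
  refine continuousAt_of_locally_uniform_approx_of_continuousAt fun u hu => ?_
  obtain ⟨ε, hε, hu⟩ := Metric.mem_uniformity_dist.1 hu
  obtain ⟨M, hM, hM'⟩ := hη.eventually_norm_lt z₀
  obtain ⟨v, hv, hv'⟩ := hξ z₀ (ε / 2 / M) (by positivity)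
  have hvM := ((isSection_of_mem hv).eventually_norm_lt z₀)
  obtain ⟨N, hN, hN'⟩ := hvM
  obtain ⟨w, hw, hw'⟩ := hη z₀ (ε / 2 / N) (by positivity)
  refine ⟨_, hv'.and (hw'.and (hM'.and hN')), fun z => ⟪v z, w z⟫_ℂ,
    (F.continuous_inner v hv w hw).continuousAt, ?_⟩
  rintro z ⟨h1, h2, h3, h4⟩
  refine hu ?_
  rw [dist_eq_norm]
  have h5 : ⟪ξ z, η z⟫_ℂ - ⟪v z, w z⟫_ℂ = ⟪ξ z - v z, η z⟫_ℂ + ⟪v z, η z - w z⟫_ℂ := by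
    rw [inner_sub_left, inner_sub_right]
    abel
  rw [h5]
  refine (norm_add_le _ _).trans_lt ?_
  have h6 := norm_inner_le_norm (𝕜 := ℂ) (ξ z - v z) (η z)
  have h7 := norm_inner_le_norm (𝕜 := ℂ) (v z) (η z - w z)
  have h8 : ‖ξ z - v z‖ * ‖η z‖ < ε / 2 := by
    rw [← div_mul_cancel₀ (ε / 2) hM.ne']
    exact mul_lt_mul'' h1 h3 (norm_nonneg _) (norm_nonneg _)
  have h9 : ‖v z‖ * ‖η z - w z‖ < ε / 2 := by
    rw [← mul_div_cancel₀ (ε / 2) hN.ne']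
    exact mul_lt_mul'' h4 h2 (norm_nonneg _) (norm_nonneg _)
  linarith

/-- This closure under uniform limits is what makes the module of sections complete. -/
theorem isSection_of_uniform_approx
    (h : ∀ ε > 0, ∃ η, F.IsSection η ∧ ∀ z, ‖ξ z - η z‖ ≤ ε) : F.IsSection ξ := by
  intro z₀ ε hε
  obtain ⟨η, hη, h'⟩ := h (ε / 2) (half_pos hε)
  obtain ⟨v, hv, hv'⟩ := hη z₀ (ε / 2) (half_pos hε)
  refine ⟨v, hv, ?_⟩
  filter_upwards [hv'] with z hz
  have := h' z
  calc ‖ξ z - v z‖ = ‖(ξ z - η z) + (η z - v z)‖ := by rw [sub_add_sub_cancel]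
    _ ≤ ‖ξ z - η z‖ + ‖η z - v z‖ := norm_add_le _ _
    _ < ε := by linarith

/-- A value of a section vanishes if it is orthogonal to the values of all given fields. -/
theorem IsSection.eq_zero (hξ : F.IsSection ξ) {z : Z}
    (h : ∀ v ∈ F.fields, ⟪ξ z, v z⟫_ℂ = 0) : ξ z = 0 := by
  by_contra h0
  have hpos := norm_pos_iff.2 h0
  obtain ⟨v, hv, hv'⟩ := hξ z ‖ξ z‖ hpos
  have h1 := hv'.self_of_nhds
  have h2 : ⟪ξ z, ξ z - v z⟫_ℂ = (‖ξ z‖ : ℂ) ^ 2 := by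
    rw [inner_sub_right, h v hv, sub_zero]
    exact inner_self_eq_norm_sq_to_K _
  have h3 := norm_inner_le_norm (𝕜 := ℂ) (ξ z) (ξ z - v z)
  rw [h2, norm_pow, Complex.norm_real, norm_norm, sq] at h3
  exact absurd (le_of_mul_le_mul_left h3 hpos) (not_le.2 h1)

end Approximation

/-! ### The Hilbert module of sections -/

variable {A : Type u} [CommCStarAlgebra A] {H : Type} [NormedAddCommGroup H]
  [InnerProductSpace ℂ H]

/-- The Hilbert module of sections. -/
def Sections (F : VectorFieldSpace (characterSpace ℂ A) H) : Type u :=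
  {ξ : characterSpace ℂ A → H // F.IsSection ξ}

namespace Sections

variable (F : VectorFieldSpace (characterSpace ℂ A) H)

/-- The sections as an additive subgroup. -/
def addSubgroup : AddSubgroup (characterSpace ℂ A → H) where
  carrier := {ξ | F.IsSection ξ}
  zero_mem' := isSection_of_mem F.fields.zero_mem
  add_mem' := IsSection.add
  neg_mem' {ξ} h := by
    simpa [Pi.neg_def] using h.smul (g := fun _ => -1) continuous_const

noncomputable instance : AddCommGroup (Sections F) :=
  inferInstanceAs (AddCommGroup (addSubgroup F))

variable {F}

instance : CoeFun (Sections F) fun _ => characterSpace ℂ A → H := ⟨Subtype.val⟩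

theorem ext {ξ η : Sections F} (h : ∀ z, ξ z = η z) : ξ = η := Subtype.ext (funext h)

@[simp] theorem add_apply (ξ η : Sections F) (z : characterSpace ℂ A) :
    (ξ + η) z = ξ z + η z := rfl

@[simp] theorem zero_apply (z : characterSpace ℂ A) : (0 : Sections F) z = 0 := rfl

@[simp] theorem sub_apply (ξ η : Sections F) (z : characterSpace ℂ A) :
    (ξ - η) z = ξ z - η z := rfl

noncomputable instance : Module A (Sections F) where
  smul a ξ := ⟨fun z => z a • ξ z, ξ.2.smul (gelfandStarTransform A a).continuous⟩
  one_smul ξ := ext fun z => by change z 1 • ξ z = ξ z; simp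
  mul_smul a b ξ := ext fun z => by change z (a * b) • ξ z = z a • z b • ξ z; simp [mul_smul]
  smul_zero a := ext fun z => by change z a • (0 : H) = 0; simp
  smul_add a ξ η := ext fun z => smul_add (z a) (ξ z) (η z)
  add_smul a b ξ := ext fun z => by
    change z (a + b) • ξ z = z a • ξ z + z b • ξ z; simp [add_smul]
  zero_smul ξ := ext fun z => by change z 0 • ξ z = 0; simp

noncomputable instance : Module ℂ (Sections F) where
  smul c ξ := ⟨fun z => c • ξ z, ξ.2.smul continuous_const⟩
  one_smul _ := ext fun _ => one_smul _ _
  mul_smul _ _ _ := ext fun _ => mul_smul _ _ _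
  smul_zero _ := ext fun _ => smul_zero _
  smul_add _ _ _ := ext fun _ => smul_add _ _ _
  add_smul _ _ _ := ext fun _ => add_smul _ _ _
  zero_smul _ := ext fun _ => zero_smul _ _

@[simp] theorem smul_apply (a : A) (ξ : Sections F) (z : characterSpace ℂ A) :
    (a • ξ) z = z a • ξ z := rfl

@[simp] theorem complex_smul_apply (c : ℂ) (ξ : Sections F) (z : characterSpace ℂ A) :
    (c • ξ) z = c • ξ z := rfl

noncomputable instance : Inner A (Sections F) where
  inner ξ η := (gelfandStarTransform A).symm ⟨fun z => ⟪ξ z, η z⟫_ℂ, ξ.2.continuous_inner η.2⟩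

theorem apply_inner (ξ η : Sections F) (z : characterSpace ℂ A) :
    z (inner A ξ η) = ⟪ξ z, η z⟫_ℂ := by
  have h : gelfandStarTransform A (inner A ξ η) z = ⟪ξ z, η z⟫_ℂ := by
    change gelfandStarTransform A ((gelfandStarTransform A).symm _) z = _
    rw [(gelfandStarTransform A).apply_symm_apply]
    rfl
  exact h

noncomputable instance : Norm (Sections F) where
  norm ξ := √‖inner A ξ ξ‖

variable [PartialOrder A] [StarOrderedRing A]

theorem inner_self_nonneg' (ξ : Sections F) : 0 ≤ inner A ξ ξ := by
  -- The pointwise norm is continuous, hence an element of `A`, and `⟨ξ, ξ⟩` is its square.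
  let r : A := (gelfandStarTransform A).symm
    ⟨fun z => (‖ξ z‖ : ℂ), Complex.continuous_ofReal.comp
      (continuous_norm_of_continuous_inner (ξ.2.continuous_inner ξ.2))⟩
  have hr (z : characterSpace ℂ A) : z r = ‖ξ z‖ := by
    have h : gelfandStarTransform A r z = ‖ξ z‖ := by
      rw [(gelfandStarTransform A).apply_symm_apply]
      rfl
    exact h
  have : inner A ξ ξ = star r * r := character_ext fun z => by
    rw [apply_inner, map_mul, map_star, hr, inner_self_eq_norm_sq_to_K, RCLike.star_def,
      Complex.conj_ofReal, sq]
    rfl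
  rw [this]
  exact star_mul_self_nonneg r

noncomputable instance : CStarModule A (Sections F) where
  inner_add_right {ξ η ζ} := character_ext fun z => by
    rw [map_add, apply_inner, apply_inner, apply_inner, add_apply, inner_add_right]
  inner_self_nonneg {ξ} := inner_self_nonneg' ξ
  inner_self {ξ} := by
    refine ⟨fun h => ext fun z => ?_, ?_⟩
    · rw [zero_apply, ← inner_self_eq_zero (𝕜 := ℂ), ← apply_inner, h, map_zero]
    · rintro rfl
      exact character_ext fun z => by rw [apply_inner, zero_apply, inner_zero_left, map_zero]
  inner_op_smul_right {a ξ η} := character_ext fun z => by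
    rw [map_mul, apply_inner, apply_inner, smul_apply, inner_smul_right]
  inner_smul_right_complex {c ξ η} := character_ext fun z => by
    rw [map_smul, apply_inner, apply_inner, complex_smul_apply, inner_smul_right, smul_eq_mul]
  star_inner ξ η := character_ext fun z => by
    rw [map_star, apply_inner, apply_inner, RCLike.star_def, inner_conj_symm]
  norm_eq_sqrt_norm_inner_self ξ := rfl

noncomputable instance : NormedAddCommGroup (Sections F) :=
  NormedAddCommGroup.ofCore (CStarModule.normedSpaceCore A)

noncomputable instance : NormedSpace ℂ (Sections F) :=
  NormedSpace.ofCore (CStarModule.normedSpaceCore A)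

/-- The Gelfand transform is isometric, so the module norm is the supremum of the pointwise norms;
`norm_le` is the other half. -/
theorem norm_apply_le (ξ : Sections F) (z : characterSpace ℂ A) : ‖ξ z‖ ≤ ‖ξ‖ := by
  refine le_of_sq_le_sq ?_ (norm_nonneg _)
  rw [CStarModule.norm_sq_eq A (E := Sections F), ← norm_inner_self, ← apply_inner,
    ← (gelfandTransform_isometry A).norm_map_of_map_zero (map_zero _)]
  exact (gelfandTransform ℂ A (inner A ξ ξ)).norm_coe_le_norm z

theorem norm_le {ξ : Sections F} {ε : ℝ} (hε : 0 ≤ ε) (h : ∀ z, ‖ξ z‖ ≤ ε) : ‖ξ‖ ≤ ε := by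
  refine le_of_sq_le_sq ?_ hε
  rw [CStarModule.norm_sq_eq A (E := Sections F),
    ← (gelfandTransform_isometry A).norm_map_of_map_zero (map_zero _)]
  refine (ContinuousMap.norm_le _ (sq_nonneg _)).2 fun z => ?_
  change ‖z (inner A ξ ξ)‖ ≤ _
  rw [apply_inner, norm_inner_self]
  exact pow_le_pow_left₀ (norm_nonneg _) (h z) 2

instance [CompleteSpace H] : CompleteSpace (Sections F) := by
  refine Metric.complete_of_cauchySeq_tendsto fun u hu => ?_
  have hc (z : characterSpace ℂ A) : CauchySeq fun n => u n z := by
    rw [Metric.cauchySeq_iff] at hu ⊢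
    intro ε hε
    obtain ⟨N, hN⟩ := hu ε hε
    refine ⟨N, fun m hm n hn => lt_of_le_of_lt ?_ (hN m hm n hn)⟩
    rw [dist_eq_norm, dist_eq_norm]
    exact norm_apply_le (u m - u n) z
  choose g hg using fun z => cauchySeq_tendsto_of_complete (hc z)
  have key : ∀ ε > 0, ∃ N, ∀ n ≥ N, ∀ z, ‖u n z - g z‖ ≤ ε := by
    intro ε hε
    obtain ⟨N, hN⟩ := Metric.cauchySeq_iff.1 hu ε hε
    refine ⟨N, fun n hn z => ?_⟩
    refine le_of_tendsto (tendsto_const_nhds.sub (hg z)).norm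
      (Filter.eventually_atTop.2 ⟨N, fun m hm => ?_⟩)
    have h := hN n hn m hm
    rw [dist_eq_norm] at h
    exact (norm_apply_le (u n - u m) z).trans h.le
  obtain ⟨v, hv⟩ : ∃ v : Sections F, ∀ z, v z = g z :=
    ⟨⟨g, isSection_of_uniform_approx fun ε hε => by
      obtain ⟨N, hN⟩ := key ε hε
      exact ⟨u N, (u N).2, fun z => norm_sub_rev (u N z) (g z) ▸ hN N le_rfl z⟩⟩, fun _ => rfl⟩
  refine ⟨v, Metric.tendsto_atTop.2 fun ε hε => ?_⟩
  obtain ⟨N, hN⟩ := key (ε / 2) (half_pos hε)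
  refine ⟨N, fun n hn => ?_⟩
  rw [dist_eq_norm]
  refine (norm_le (half_pos hε).le fun z => ?_).trans_lt (half_lt_self hε)
  rw [sub_apply, hv]
  exact hN n hn z

end Sections

end VectorFieldSpace

/-! ### A function positive along a sequence and zero at a limit point -/

/-- In an infinite compact Hausdorff space there is a nonnegative continuous function that vanishes
at a limit point of a sequence of points where it is positive. -/
theorem exists_continuous_pos_seq (Z : Type*) [TopologicalSpace Z] [CompactSpace Z] [T2Space Z]
    [Infinite Z] :
    ∃ (f : C(Z, ℝ)) (u : ℕ → Z) (z : Z), (∀ w, 0 ≤ f w) ∧ (∀ n, 0 < f (u n)) ∧ f z = 0 ∧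
      z ∈ closure (Set.range u) := by
  obtain ⟨U, hUi, hUo, hUd⟩ := exists_seq_infinite_isOpen_pairwise_disjoint Z
  choose u hu using fun n => (hUi n).nonempty
  have hg (n : ℕ) : ∃ g : C(Z, ℝ), Set.EqOn g 0 (U n)ᶜ ∧ Set.EqOn g 1 {u n} ∧
      ∀ z, g z ∈ Set.Icc (0 : ℝ) 1 :=
    exists_continuous_zero_one_of_isClosed (hUo n).isClosed_compl isClosed_singleton
      (Set.disjoint_singleton_right.2 fun h => h (hu n))
  choose g hg0 hg1 hgI using hg
  have hb (n : ℕ) (z : Z) : ‖(1 / 2 : ℝ) ^ n * g n z‖ ≤ (1 / 2 : ℝ) ^ n := by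
    rw [Real.norm_of_nonneg (mul_nonneg (by positivity) (hgI n z).1)]
    exact mul_le_of_le_one_right (by positivity) (hgI n z).2
  -- The geometric weights give uniform convergence and force `f (u n) → 0`: the `U n` are disjoint,
  -- so only the `n`-th bump survives at `u n`.
  let f : C(Z, ℝ) := ⟨fun z => ∑' n, (1 / 2 : ℝ) ^ n * g n z,
    continuous_tsum (fun n => by fun_prop) summable_geometric_two hb⟩
  have hf (n : ℕ) : f (u n) = (1 / 2 : ℝ) ^ n := by
    change ∑' m, (1 / 2 : ℝ) ^ m * g m (u n) = _
    rw [tsum_eq_single n, hg1 n rfl, Pi.one_apply, mul_one]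
    intro m hm
    rw [hg0 m fun h => Set.disjoint_left.1 (hUd hm) h (hu n), Pi.zero_apply, mul_zero]
  -- `Z` need not be sequentially compact, so a cluster point replaces a convergent subsequence.
  obtain ⟨z, hz⟩ := exists_clusterPt_of_compactSpace (Filter.map u Filter.atTop)
  have hz : MapClusterPt z Filter.atTop u := hz
  refine ⟨f, u, z, fun w => tsum_nonneg fun n => mul_nonneg (by positivity) (hgI n w).1,
    fun n => by rw [hf]; positivity, ?_, ?_⟩
  · have h1 : MapClusterPt (f z) Filter.atTop (f ∘ u) :=
      hz.continuousAt_comp f.continuous.continuousAt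
    have h2 : Filter.Tendsto (f ∘ u) Filter.atTop (𝓝 0) :=
      (tendsto_pow_atTop_nhds_zero_of_lt_one (by norm_num) (by norm_num)).congr fun n => (hf n).symm
    have h3 : ClusterPt (f z) (𝓝 (0 : ℝ)) := h1.clusterPt.mono h2
    exact eq_of_nhds_neBot h3
  · refine mem_closure_iff_nhds.2 fun t ht => ?_
    obtain ⟨n, hn⟩ := (hz.frequently ht).exists
    exact ⟨u n, hn, n, rfl⟩

/-! ### Cutoffs and branches of the binary tree -/

/-- The difference of two consecutive cutoffs `max 0 (1 - k t)`.  For `t > 0` these sum to `1`. -/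
noncomputable def cutoffDiff (k : ℕ) (t : ℝ) : ℝ :=
  max 0 (1 - k * t) - max 0 (1 - (k + 1 : ℕ) * t)

theorem continuous_cutoffDiff (k : ℕ) : Continuous (cutoffDiff k) := by
  unfold cutoffDiff
  fun_prop

theorem cutoffDiff_zero (k : ℕ) : cutoffDiff k 0 = 0 := by simp [cutoffDiff]

theorem cutoffDiff_nonneg (k : ℕ) {t : ℝ} (ht : 0 ≤ t) : 0 ≤ cutoffDiff k t := by
  refine sub_nonneg.2 (max_le_max le_rfl ?_)
  push_cast
  linarith

theorem one_sub_mul_nonpos {k : ℕ} {t : ℝ} (ht : 0 < t) (hk : ⌈t⁻¹⌉₊ ≤ k) : 1 - k * t ≤ 0 := by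
  have h := (Nat.le_ceil t⁻¹).trans (Nat.cast_le.2 hk)
  rw [inv_le_iff_one_le_mul₀ ht] at h
  linarith

theorem cutoffDiff_eq_zero {k : ℕ} {t : ℝ} (ht : 0 < t) (hk : ⌈t⁻¹⌉₊ ≤ k) : cutoffDiff k t = 0 := by
  rw [cutoffDiff, max_eq_left (one_sub_mul_nonpos ht hk),
    max_eq_left (one_sub_mul_nonpos ht (hk.trans k.le_succ)), sub_zero]

/-- The sum telescopes from `1` down to a cutoff that vanishes. It makes the branches unit vectors.
-/
theorem sum_cutoffDiff {t : ℝ} (ht : 0 < t) : ∑ k ∈ Finset.range ⌈t⁻¹⌉₊, cutoffDiff k t = 1 := by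
  have h := Finset.sum_range_sub' (fun k : ℕ => max 0 (1 - k * t)) ⌈t⁻¹⌉₊
  simp only [max_eq_left (one_sub_mul_nonpos ht le_rfl)] at h
  simpa [cutoffDiff] using h

/-- The index set of an orthonormal basis: finite and infinite binary sequences. -/
abbrev BinaryWord : Type := (Σ k : ℕ, Fin k → Bool) ⊕ (ℕ → Bool)

/-- The Hilbert space with a basis of finite and infinite binary sequences. -/
abbrev TreeSpace : Type := lp (fun _ : BinaryWord => ℂ) 2

/-- The standard orthonormal basis. -/
noncomputable def treeBasis : HilbertBasis BinaryWord ℂ TreeSpace :=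
  .ofRepr (LinearIsometryEquiv.refl ℂ TreeSpace)

/-- The initial segment of length `k` of a binary sequence. -/
def initialSegment (s : ℕ → Bool) (k : ℕ) : Σ k : ℕ, Fin k → Bool := ⟨k, fun i => s i⟩

theorem initialSegment_eq_iff {s t : ℕ → Bool} {k l : ℕ} :
    initialSegment s k = initialSegment t l ↔ k = l ∧ ∀ i < k, s i = t i := by
  constructor
  · intro h
    obtain rfl : k = l := congrArg Sigma.fst h
    refine ⟨rfl, fun i hi => ?_⟩
    exact congrFun (eq_of_heq (Sigma.mk.inj h).2) ⟨i, hi⟩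
  · rintro ⟨rfl, h⟩
    exact congrArg (Sigma.mk k) (funext fun i => h i i.2)

section Branch

open Classical in
/-- A path of unit vectors, for `t > 0` finite combinations of initial segments of `s`, and for
`t = 0` the basis vector of `s` itself. -/
noncomputable def branch (s : ℕ → Bool) (t : ℝ) : TreeSpace :=
  if t = 0 then treeBasis (.inr s) else
    ∑ k ∈ Finset.range ⌈t⁻¹⌉₊, (√(cutoffDiff k t) : ℂ) • treeBasis (.inl (initialSegment s k))

theorem branch_zero (s : ℕ → Bool) : branch s 0 = treeBasis (.inr s) := if_pos rfl

theorem branch_congr {s s' : ℕ → Bool} {t : ℝ} (ht : 0 < t) (h : ∀ i < ⌈t⁻¹⌉₊, s i = s' i) :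
    branch s t = branch s' t := by
  rw [branch, branch, if_neg ht.ne', if_neg ht.ne']
  refine Finset.sum_congr rfl fun k hk => ?_
  rw [initialSegment_eq_iff.2 ⟨rfl, fun i hi => h i (hi.trans (Finset.mem_range.1 hk))⟩]

/-- At a fixed `t > 0` there are only finitely many branches. -/
theorem finite_range_branch {t : ℝ} (ht : 0 < t) : (Set.range fun s => branch s t).Finite := by
  let extend (r : Fin ⌈t⁻¹⌉₊ → Bool) (i : ℕ) : Bool := if h : i < ⌈t⁻¹⌉₊ then r ⟨i, h⟩ else false
  refine (Set.finite_range fun r => branch (extend r) t).subset ?_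
  rintro _ ⟨s, rfl⟩
  exact ⟨fun i => s i, branch_congr ht fun i hi => dif_pos hi⟩

-- By orthonormality only segments of equal length can pair, and they do exactly while `s` and `s'`
-- agree; the square roots in `branch` multiply to the weight `cutoffDiff`.
open Classical in
theorem inner_branch_of_pos (s s' : ℕ → Bool) {t : ℝ} (ht : 0 < t) :
    ⟪branch s t, branch s' t⟫_ℂ =
      ∑ k ∈ Finset.range ⌈t⁻¹⌉₊, if ∀ i < k, s i = s' i then (cutoffDiff k t : ℂ) else 0 := by
  have ho := orthonormal_iff_ite.1 treeBasis.orthonormal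
  rw [branch, branch, if_neg ht.ne', if_neg ht.ne', sum_inner]
  refine Finset.sum_congr rfl fun k hk => ?_
  rw [inner_sum, Finset.sum_eq_single k]
  · rw [inner_smul_left, inner_smul_right, ho, Complex.conj_ofReal]
    simp only [Sum.inl.injEq, initialSegment_eq_iff, true_and]
    split_ifs
    · rw [mul_one, ← Complex.ofReal_mul, Real.mul_self_sqrt (cutoffDiff_nonneg k ht.le)]
    · simp
  · intro l _ hl
    rw [inner_smul_left, inner_smul_right, ho, if_neg, mul_zero, mul_zero]
    simp only [Sum.inl.injEq, initialSegment_eq_iff]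
    exact fun h => hl h.1.symm
  · exact fun h => absurd hk h

theorem inner_branch_self (s : ℕ → Bool) {t : ℝ} (ht : 0 ≤ t) :
    ⟪branch s t, branch s t⟫_ℂ = 1 := by
  classical
  rcases ht.eq_or_lt with rfl | ht
  · rw [branch_zero, orthonormal_iff_ite.1 treeBasis.orthonormal, if_pos rfl]
  · rw [inner_branch_of_pos s s ht]
    simp only [implies_true, if_true]
    rw [← Complex.ofReal_sum, sum_cutoffDiff ht, Complex.ofReal_one]

-- Segments of length greater than `n` contain the letter where `s` and `s'` differ, so only lengths
-- `0, …, n` contribute. The number of terms no longer depends on `t`, and at `t = 0` every weight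
-- vanishes, matching the orthogonality of the two basis vectors.
open Classical in
theorem inner_branch_of_ne {s s' : ℕ → Bool} {n : ℕ} (hn : s n ≠ s' n) {t : ℝ} (ht : 0 ≤ t) :
    ⟪branch s t, branch s' t⟫_ℂ =
      ∑ k ∈ Finset.range (n + 1), if ∀ i < k, s i = s' i then (cutoffDiff k t : ℂ) else 0 := by
  rcases ht.eq_or_lt with rfl | ht
  · have : s ≠ s' := fun h => hn (congrFun h n)
    rw [branch_zero, branch_zero, orthonormal_iff_ite.1 treeBasis.orthonormal, if_neg (by simpa)]
    simp [cutoffDiff_zero]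
  · rw [inner_branch_of_pos s s' ht]
    rcases le_total ⌈t⁻¹⌉₊ (n + 1) with h | h
    · refine Finset.sum_subset (Finset.range_mono h) fun k _ hk => ?_
      rw [cutoffDiff_eq_zero ht (by simpa using hk), Complex.ofReal_zero, ite_self]
    · refine (Finset.sum_subset (Finset.range_mono h) fun k _ hk => if_neg fun h' => ?_).symm
      exact hn (h' n (by simpa using hk))

end Branch

section Field

variable {Z : Type*} [TopologicalSpace Z] {f : C(Z, ℝ)}

/-- Only inner products are continuous: as vectors of `TreeSpace` the branches jump at `t = 0`, to a
vector orthogonal to all earlier ones. -/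
theorem continuous_inner_branch (hf : ∀ z, 0 ≤ f z) (s s' : ℕ → Bool) :
    Continuous fun z => ⟪branch s (f z), branch s' (f z)⟫_ℂ := by
  classical
  rcases eq_or_ne s s' with rfl | h
  · simp only [inner_branch_self s (hf _)]
    exact continuous_const
  · obtain ⟨n, hn⟩ := Function.ne_iff.1 h
    simp only [inner_branch_of_ne hn (hf _)]
    refine continuous_finsetSum _ fun k _ => ?_
    split_ifs
    · exact Complex.continuous_ofReal.comp ((continuous_cutoffDiff k).comp f.continuous)
    · exact continuous_const

/-- The vector fields spanned by the branches, pulled back along a nonnegative function. -/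
noncomputable def branchFields (hf : ∀ z, 0 ≤ f z) : VectorFieldSpace Z TreeSpace where
  fields := Submodule.span ℂ (Set.range fun s z => branch s (f z))
  continuous_inner v hv w hw := by
    induction hv using Submodule.span_induction with
    | mem v hv =>
      obtain ⟨s, rfl⟩ := hv
      induction hw using Submodule.span_induction with
      | mem w hw =>
        obtain ⟨s', rfl⟩ := hw
        exact continuous_inner_branch hf s s'
      | zero => simp [continuous_const]
      | add w w' _ _ h h' => simpa only [Pi.add_apply, inner_add_right] using Continuous.fun_add h h'
      | smul c w _ h => simpa only [Pi.smul_apply, inner_smul_right] using h.const_mul c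
    | zero => simp [continuous_const]
    | add v v' _ _ h h' => simpa only [Pi.add_apply, inner_add_left] using Continuous.fun_add h h'
    | smul c v _ h => simpa only [Pi.smul_apply, inner_smul_left] using h.const_mul _

end Field

instance uncountable_nat_bool : Uncountable (ℕ → Bool) := by
  rw [← Cardinal.aleph0_lt_mk_iff]
  simp [Cardinal.aleph0_lt_continuum]

/-! ### The module of sections has no frame -/

section NoFrame

variable {A : Type u} [CommCStarAlgebra A] {f : C(characterSpace ℂ A, ℝ)} (hf : ∀ z, 0 ≤ f z)

open VectorFieldSpace

/-- The section of the field of branches that is given by a branch. -/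
noncomputable def branchSection (s : ℕ → Bool) : Sections (branchFields hf) :=
  ⟨fun z => branch s (f z), isSection_of_mem (Submodule.subset_span ⟨s, rfl⟩)⟩

/-- Orthogonality is linear in the field, so the spanning branches suffice. Where `f z > 0` this
leaves finitely many test vectors. -/
theorem Sections.eq_zero_of_inner_branch {hf : ∀ z, 0 ≤ f z} {ξ : Sections (branchFields hf)}
    {z : characterSpace ℂ A} (h : ∀ s, ⟪ξ z, branch s (f z)⟫_ℂ = 0) : ξ z = 0 := by
  refine ξ.2.eq_zero fun v hv => ?_
  induction hv using Submodule.span_induction with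
  | mem v hv => obtain ⟨s, rfl⟩ := hv; exact h s
  | zero => exact inner_zero_right _
  | add v v' _ _ h h' => rw [Pi.add_apply, inner_add_right, h, h', add_zero]
  | smul c v _ h => rw [Pi.smul_apply, inner_smul_right, h, mul_zero]

variable [PartialOrder A] [StarOrderedRing A]

/-- The module of sections of the field of branches has no frame if the function has a zero that is
a limit of a sequence of points where it is positive. -/
theorem not_isFrame_sections {u : ℕ → characterSpace ℂ A} (hu : ∀ n, 0 < f (u n))
    {z : characterSpace ℂ A} (hz : f z = 0) (hzu : z ∈ closure (Set.range u)) {J : Type*}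
    (x : J → Sections (branchFields hf)) : ¬ IsFrame A x := by
  intro hx
  obtain ⟨C, hC, hx⟩ := hx.exists_hasSum_character
  -- Each of the finitely many branch vectors at `w` has a convergent frame sum, so it pairs
  -- nontrivially with countably many `x j w`; a nonzero `x j w` pairs nontrivially with one of
  -- them.
  have hcount (w : characterSpace ℂ A) (hw : 0 < f w) : {j | x j w ≠ 0}.Countable := by
    have hfin := finite_range_branch hw
    refine (hfin.countable.biUnion (t := fun v _ => {j | ⟪x j w, v⟫_ℂ ≠ 0}) ?_).mono ?_
    · rintro _ ⟨s, rfl⟩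
      obtain ⟨r, hr, -⟩ := hx (branchSection hf s) w
      refine hr.summable.countable_support.mono fun j hj => ?_
      rw [Function.mem_support, Sections.apply_inner]
      exact pow_ne_zero 2 (norm_ne_zero_iff.2 hj)
    · intro j hj
      by_contra h
      simp only [Set.mem_iUnion, not_exists] at h
      exact hj (Sections.eq_zero_of_inner_branch fun s => not_not.1 (h _ ⟨s, rfl⟩))
  -- A section vanishing at every `u n` vanishes at their limit point `z`, because its squared norm
  -- is continuous.
  have hJ : {j | x j z ≠ 0}.Countable := by
    refine (Set.countable_iUnion fun n => hcount (u n) (hu n)).mono fun j hj => ?_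
    by_contra h
    simp only [Set.mem_iUnion, not_exists] at h
    have hclosed : IsClosed {w | ⟪x j w, x j w⟫_ℂ = 0} :=
      isClosed_eq ((x j).2.continuous_inner (x j).2) continuous_const
    have := closure_minimal (s := Set.range u) (by
      rintro _ ⟨n, rfl⟩
      exact inner_self_eq_zero.2 (not_not.1 (h n))) hclosed hzu
    exact hj (inner_self_eq_zero.1 this)
  refine Set.not_countable_univ (α := ℕ → Bool) ?_
  -- By Bessel's inequality each `x j z` pairs nontrivially with countably many basis vectors; it
  -- remains to see that every `s` is met by some `j` with `x j z ≠ 0`.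
  refine (hJ.biUnion (t := fun j _ => {s | ⟪treeBasis (.inr s), x j z⟫_ℂ ≠ 0}) ?_).mono ?_
  · intro j _
    have := (treeBasis.orthonormal.comp Sum.inr Sum.inr_injective).inner_products_summable (x j z)
    exact this.countable_support.mono fun s hs => by simpa using hs
  · intro s _
    obtain ⟨r, hr, hCr⟩ := hx (branchSection hf s) z
    simp only [Sections.apply_inner] at hr hCr
    have hs : branchSection hf s z = treeBasis (.inr s) := by
      rw [← branch_zero, ← hz]
      rfl
    have h1 : ⟪branchSection hf s z, branchSection hf s z⟫_ℂ = 1 := inner_branch_self s (hf z)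
    rw [h1, Complex.one_re, mul_one] at hCr
    -- An `s` that is missed would have frame sum `0` at `z`, although the lower bound there is `C >
    -- 0`.
    by_contra h
    simp only [Set.mem_iUnion, not_exists] at h
    have h0 (j : J) : ‖⟪x j z, branchSection hf s z⟫_ℂ‖ ^ 2 = 0 := by
      rw [hs]
      by_cases hj : x j z = 0
      · rw [hj, inner_zero_left, norm_zero, zero_pow two_ne_zero]
      · rw [inner_eq_zero_symm.1 (not_not.1 (h j hj)), norm_zero, zero_pow two_ne_zero]
    simp only [h0] at hr
    exact absurd (hr.unique hasSum_zero) (by linarith : 0 < r).ne'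

end NoFrame

/-- A commutative C⋆-algebra of infinite dimension has a Hilbert module without frames. -/
theorem exists_hilbertModule_without_frame (A : Type u) [CommCStarAlgebra A] [PartialOrder A]
    [StarOrderedRing A] (hA : ¬ FiniteDimensional ℂ A) :
    ∃ (X : Type u) (_ : NormedAddCommGroup X) (_ : NormedSpace ℂ X) (_ : Module A X)
      (_ : CStarModule A X) (_ : CompleteSpace X), ∀ (J : Type u) (x : J → X), ¬ IsFrame A x := by
  have : Infinite (characterSpace ℂ A) := by
    by_contra h
    have := not_infinite_iff_finite.1 h
    exact hA (finiteDimensional_of_finite_characterSpace A)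
  obtain ⟨f, u, z, hf, hu, hz, hzu⟩ := exists_continuous_pos_seq (characterSpace ℂ A)
  exact ⟨VectorFieldSpace.Sections (branchFields hf), inferInstance, inferInstance, inferInstance,
    inferInstance, inferInstance, fun J x => not_isFrame_sections hf hu hz hzu x⟩

/-! ### The equivalences -/

theorem theorem1p1 (A : Type u) [CommCStarAlgebra A] [PartialOrder A] [StarOrderedRing A] :
    List.TFAE [
      FiniteDimensional ℂ A,
      ∀ (X : Type u) [NormedAddCommGroup X] [NormedSpace ℂ X] [Module A X] [CStarModule A X]
        [CompleteSpace X],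
        ∃ J : Type u,
          HilbertModuleIso A C⋆ᵐᵒᵈ(A, X × StandardModule A J) (StandardModule A J),
      ∀ (X : Type u) [NormedAddCommGroup X] [NormedSpace ℂ X] [Module A X] [CStarModule A X]
        [CompleteSpace X],
        ∃ (J : Type u) (Y : Type u) (_ : NormedAddCommGroup Y) (_ : NormedSpace ℂ Y)
          (_ : Module A Y) (_ : CStarModule A Y) (_ : CompleteSpace Y),
          HilbertModuleIso A C⋆ᵐᵒᵈ(A, X × Y) (StandardModule A J),
      ∀ (X : Type u) [NormedAddCommGroup X] [NormedSpace ℂ X] [Module A X] [CStarModule A X]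
        [CompleteSpace X],
        ∃ (J : Type u) (x : J → X), IsStandardFrame A x,
      ∀ (X : Type u) [NormedAddCommGroup X] [NormedSpace ℂ X] [Module A X] [CStarModule A X]
        [CompleteSpace X],
        ∃ (J : Type u) (x : J → X), IsFrame A x] ∧
    (¬ FiniteDimensional ℂ A →
      ∃ (X : Type u) (_ : NormedAddCommGroup X) (_ : NormedSpace ℂ X) (_ : Module A X)
        (_ : CStarModule A X) (_ : CompleteSpace X),
        (¬ ∃ (J : Type u) (x : J → X), IsFrame A x) ∧
        ¬ ∃ J : Type u,
          HilbertModuleIso A C⋆ᵐᵒᵈ(A, X × StandardModule A J) (StandardModule A J)) := by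
  have absorb : FiniteDimensional ℂ A → ∀ (X : Type u) [NormedAddCommGroup X] [NormedSpace ℂ X]
      [Module A X] [CStarModule A X] [CompleteSpace X], ∃ J : Type u,
        HilbertModuleIso A C⋆ᵐᵒᵈ(A, X × StandardModule A J) (StandardModule A J) := by
    intro _ X _ _ _ _ _
    exact exists_hilbertModuleIso_prod_standardModule X
  refine ⟨?_, fun hA => ?_⟩
  · tfae_have 1 → 2 := absorb
    tfae_have 2 → 3 := by
      intro h X _ _ _ _ _
      obtain ⟨J, hJ⟩ := h X
      exact ⟨J, StandardModule A J, inferInstance, inferInstance, inferInstance, inferInstance,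
        inferInstance, hJ⟩
    tfae_have 3 → 4 := by
      intro h X _ _ _ _ _
      obtain ⟨J, Y, _, _, _, _, _, hJ⟩ := h X
      exact ⟨J, hJ.exists_isStandardFrame⟩
    tfae_have 4 → 5 := by
      intro h X _ _ _ _ _
      obtain ⟨J, x, hx⟩ := h X
      exact ⟨J, x, hx.1⟩
    tfae_have 5 → 1 := by
      intro h
      by_contra hA
      obtain ⟨X, _, _, _, _, _, hX⟩ := exists_hilbertModule_without_frame A hA
      obtain ⟨J, x, hx⟩ := h X
      exact hX J x hx
    tfae_finish
  · obtain ⟨X, i₁, i₂, i₃, i₄, i₅, hX⟩ := exists_hilbertModule_without_frame A hA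
    refine ⟨X, i₁, i₂, i₃, i₄, i₅, fun ⟨J, x, hx⟩ => hX J x hx, fun ⟨J, hJ⟩ => ?_⟩
    -- Absorption would make `X` a summand of a standard module and so give it a frame.
    obtain ⟨x, hx⟩ := hJ.exists_isStandardFrame
    exact hX J x hx.1
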